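/- In the problem $R2||C_{\max}$ the input consists of $n$ jobs and processing times $p_{i,j}\in\mathbb N=\{0,1,2,\dots\}$ for $i\in\{1,2\}$ and $j\in\{1,\dots,n\}$, where $p_{i,j}$ is the time that machine $i$ needs for job $j$. A schedule is a map $\sigma:\{1,\dots,n\}\to\{1,2\}$, its makespan is $C_{\max}(\sigma)=\max_{i\in\{1,2\}}\sum_{j:\,\sigma(j)=i}p_{i,j}$, and the task is to compute a schedule of minimum makespan together with its makespan. Let $p_{\max}=\max_{i,j}p_{i,j}$ (and $p_{\max}=0$ if $n=0$). **Corollary.** $R2||C_{\max}$ can be solved in $\widetilde O(p_{\max}^6\cdot n)$ time, where $\widetilde O$ suppresses polylogarithmic factors. That is, there are a single program for a random access machine and constants $K,k\in\mathbb N$ such that, on every instance, the program halts with an optimal schedule and the optimal makespan as its output, after running for time at most $$K\cdot \max(p_{\max},1)^6\cdot \max(n,1)\cdot \lfloor\log_2(n+p_{\max}+2)\rfloor^{k}.$$ Here the machine stores natural numbers in its registers and memory cells, has indirect addressing, addition, truncated subtraction, multiplication, integer division and comparisons, and running time is measured by the logarithmic cost criterion: each elementary step costs one plus the total bit length of the numbers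 it handles, including memory addresses. -/

import Mathlib

/-! ## Makespan minimization on unrelated parallel machines -/

namespace Makespan

/-- The total load that the assignment `σ` puts on machine `i`, where `p i j` is the time that
machine `i` needs for job `j`. -/
def load {m n : ℕ} (p : Fin m → Fin n → ℕ) (σ : Fin n → Fin m) (i : Fin m) : ℕ :=
  ∑ j ∈ Finset.univ.filter (fun j => σ j = i), p i j

/-- The makespan of the assignment `σ`: the largest load of a machine. -/
def makespan {m n : ℕ} (p : Fin m → Fin n → ℕ) (σ : Fin n → Fin m) : ℕ :=
  Finset.univ.sup (load p σ)

/-- `σ` is a schedule of minimum makespan. -/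
def IsOptimal {m n : ℕ} (p : Fin m → Fin n → ℕ) (σ : Fin n → Fin m) : Prop :=
  ∀ τ : Fin n → Fin m, makespan p σ ≤ makespan p τ

/-- The largest time `p i j` over all machines and jobs (`0` if there are none). -/
def pmax {m n : ℕ} (p : Fin m → Fin n → ℕ) : ℕ :=
  Finset.univ.sup fun i => Finset.univ.sup fun j => p i j

end Makespan

/-! ## Random access machines with logarithmic cost

A machine has named registers and a memory whose cells are addressed by natural numbers; registers
and cells hold natural numbers. A program is a finite text, so it names only finitely many
registers. Each elementary step costs one plus the bit lengths of the numbers it handles,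
addresses included. -/

namespace RAM

/-- Register contents and memory contents. -/
structure State where
  reg : ℕ → ℕ
  mem : ℕ → ℕ

/-- Write the value `v` into register `x`. -/
def State.setReg (s : State) (x v : ℕ) : State :=
  { s with reg := Function.update s.reg x v }

/-- Write the value `v` into memory cell `a`. -/
def State.setMem (s : State) (a v : ℕ) : State :=
  { s with mem := Function.update s.mem a v }

/-- Arithmetic operations on natural numbers. -/
inductive Op where
  | add | sub | mul | div

/-- Subtraction is truncated at `0`; division rounds down, and division by `0` yields `0`. -/
def Op.eval : Op → ℕ → ℕ → ℕ
  | .add, a, b => a + b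
  | .sub, a, b => a - b
  | .mul, a, b => a * b
  | .div, a, b => a / b

/-- Programs. All arguments `x y z` are names of registers. -/
inductive Program where
  /-- do nothing -/
  | skip : Program
  /-- `x := k` for a constant `k` of the program -/
  | const (x k : ℕ) : Program
  /-- `x := y op z` -/
  | arith (op : Op) (x y z : ℕ) : Program
  /-- `x := mem[y]` -/
  | load (x y : ℕ) : Program
  /-- `mem[x] := y` -/
  | store (x y : ℕ) : Program
  /-- `c; d` -/
  | seq (c d : Program) : Program
  /-- `if x < y then c else d` -/
  | ite (x y : ℕ) (c d : Program) : Program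
  /-- `while x < y do c` -/
  | loop (x y : ℕ) (c : Program) : Program

/-- `Exec c s s' t`: started in state `s`, the program `c` halts in state `s'`, and the total cost
of the steps it makes is `t`. Here `Nat.size` is the bit length of a number. -/
inductive Exec : Program → State → State → ℕ → Prop
  | skip (s : State) : Exec .skip s s 1
  | const (s : State) (x k : ℕ) : Exec (.const x k) s (s.setReg x k) (1 + k.size)
  | arith (s : State) (op : Op) (x y z : ℕ) :
      Exec (.arith op x y z) s (s.setReg x (op.eval (s.reg y) (s.reg z)))
        (1 + (s.reg y).size + (s.reg z).size)
  | load (s : State) (x y : ℕ) :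
      Exec (.load x y) s (s.setReg x (s.mem (s.reg y)))
        (1 + (s.reg y).size + (s.mem (s.reg y)).size)
  | store (s : State) (x y : ℕ) :
      Exec (.store x y) s (s.setMem (s.reg x) (s.reg y))
        (1 + (s.reg x).size + (s.reg y).size)
  | seq {c d : Program} {s s' s'' : State} {t t' : ℕ} :
      Exec c s s' t → Exec d s' s'' t' → Exec (.seq c d) s s'' (t + t')
  | ite_true {x y : ℕ} {c d : Program} {s s' : State} {t : ℕ} :
      s.reg x < s.reg y → Exec c s s' t →
        Exec (.ite x y c d) s s' (1 + (s.reg x).size + (s.reg y).size + t)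
  | ite_false {x y : ℕ} {c d : Program} {s s' : State} {t : ℕ} :
      ¬ s.reg x < s.reg y → Exec d s s' t →
        Exec (.ite x y c d) s s' (1 + (s.reg x).size + (s.reg y).size + t)
  | loop_true {x y : ℕ} {c : Program} {s s' s'' : State} {t t' : ℕ} :
      s.reg x < s.reg y → Exec c s s' t → Exec (.loop x y c) s' s'' t' →
        Exec (.loop x y c) s s'' (1 + (s.reg x).size + (s.reg y).size + t + t')
  | loop_false {x y : ℕ} {c : Program} {s : State} :
      ¬ s.reg x < s.reg y →
        Exec (.loop x y c) s s (1 + (s.reg x).size + (s.reg y).size)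

end RAM

/-! ## The two-machine problem as a task for such machines -/

namespace Makespan

/-- The initial state for an instance with two machines and `n` jobs: register `0` holds `n`, and
for each job `j < n` the cells `2 * j` and `2 * j + 1` hold its times on the two machines. All
other registers and cells hold `0`. -/
def inputState {n : ℕ} (p : Fin 2 → Fin n → ℕ) : RAM.State where
  reg x := if x = 0 then n else 0
  mem a := if h : a / 2 < n then p ⟨a % 2, Nat.mod_lt a Nat.two_pos⟩ ⟨a / 2, h⟩ else 0

/-- The state `s` shows a solution of the instance `p`: for some schedule `σ` of minimum makespan,
cell `j` holds the machine (`0` or `1`) of job `j`, and register `0` holds the makespan. -/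
def IsSolution {n : ℕ} (p : Fin 2 → Fin n → ℕ) (s : RAM.State) : Prop :=
  ∃ σ : Fin n → Fin 2, IsOptimal p σ ∧ (∀ j : Fin n, s.mem j = σ j) ∧ s.reg 0 = makespan p σ

/-- `c` solves every instance `p` of the two-machine problem at a total cost of at most `T n p`. -/
def SolvesWithin (c : RAM.Program) (T : (n : ℕ) → (Fin 2 → Fin n → ℕ) → ℕ) : Prop :=
  ∀ (n : ℕ) (p : Fin 2 → Fin n → ℕ), ∃ (s : RAM.State) (t : ℕ),
    RAM.Exec c (inputState p) s t ∧ IsSolution p s ∧ t ≤ T n p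

end Makespan

/-! Write `P` for the largest time (at least one), and `a`, `b` for the times on machines 0 and 1.
Moving jobs to machine 0 by increasing ratio `a / b` until the loads balance gives a reference set
`G` (`Greedy.reference`).

Some optimal set `S` of jobs on machine 0 is close to `G` (`Reference.exists_near`). Take the
optimal `S` nearest to `G`. If `G \ S` and `S \ G` both had `P ^ 2` jobs, pigeonhole would give `w`
jobs with `a = v` in the first and `v` jobs with `a = w` in the second. Swapping them keeps the load
of machine 0, does not raise that of machine 1 because `G` respects the ratios, and brings `S`
nearer to `G`: a contradiction (`no_exchange`). So one difference is small, and the balance of `G`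
with the optimality of `S` bounds the other; both carry a load of at most `3 * P ^ 4` on machine 0.

Hence on every suffix of the jobs the machine 0 loads of `S` and `G` differ by at most `3 * P ^ 4`,
and a dynamic program indexed by job and deviation needs only `O(n * P ^ 4)` entries. An entry
maximizes the machine 1 time saved by the jobs on machine 0. Some entry is as good as every schedule
(`Reference.exists_index`), and tracing back an entry yields a schedule of exactly its value
(`Trace.cost_eq`).

For the running time, steps are counted separately from the size of numbers: `Triple` bounds the
steps while all numbers stay below `B`. The program takes `O(n * P ^ 4)` steps on numbers of that
order, so a single logarithmic factor suffices and the sixth power leaves room. -/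

namespace RAM

/-! ### Step counting for programs with bounded numbers -/

/-- All registers and memory cells hold numbers at most `B`. -/
def Bdd (B : ℕ) (s : State) : Prop := (∀ x, s.reg x ≤ B) ∧ ∀ a, s.mem a ≤ B

/-- Started in a state with all numbers at most `B`, the program `c` halts in a state of the same
kind that satisfies `Q`, after at most `N` steps, each counted with the cost of numbers up to `B`. -/
def Triple (B : ℕ) (c : Program) (N : ℕ) (s : State) (Q : State → Prop) : Prop :=
  Bdd B s → ∃ s' t, Exec c s s' t ∧ t ≤ N * (2 * B.size + 1) ∧ Bdd B s' ∧ Q s'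

theorem Bdd.setReg {B : ℕ} {s : State} (h : Bdd B s) (x : ℕ) {v : ℕ} (hv : v ≤ B) :
    Bdd B (s.setReg x v) := by
  refine ⟨fun y => ?_, h.2⟩
  by_cases hy : y = x
  · subst hy; simpa [State.setReg] using hv
  · simpa [State.setReg, hy] using h.1 y

theorem Bdd.setMem {B : ℕ} {s : State} (h : Bdd B s) (a : ℕ) {v : ℕ} (hv : v ≤ B) :
    Bdd B (s.setMem a v) := by
  refine ⟨h.1, fun y => ?_⟩
  by_cases hy : y = a
  · subst hy; simpa [State.setMem] using hv
  · simpa [State.setMem, hy] using h.2 y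

theorem Triple.mono {B N N' : ℕ} {c : Program} {s : State} {Q Q' : State → Prop}
    (h : Triple B c N s Q) (hN : N ≤ N') (hQ : ∀ s', Q s' → Q' s') : Triple B c N' s Q' := by
  intro hs
  obtain ⟨s', t, he, ht, hb, hq⟩ := h hs
  exact ⟨s', t, he, ht.trans (Nat.mul_le_mul_right _ hN), hb, hQ _ hq⟩

theorem Triple.seq {B N N' : ℕ} {c d : Program} {s : State} {R Q : State → Prop}
    (hc : Triple B c N s R) (hd : ∀ s', R s' → Triple B d N' s' Q) :
    Triple B (.seq c d) (N + N') s Q := by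
  intro hs
  obtain ⟨s', t, he, ht, hb, hr⟩ := hc hs
  obtain ⟨s'', t', he', ht', hb', hq⟩ := hd s' hr hb
  exact ⟨s'', t + t', .seq he he', by rw [add_mul]; omega, hb', hq⟩

/-- The weakest precondition of a program without loops, with the numbers bounded by `B`. -/
def wp (B : ℕ) : Program → (State → Prop) → State → Prop
  | .skip, Q, s => Q s
  | .const x k, Q, s => k ≤ B ∧ Q (s.setReg x k)
  | .arith op x y z, Q, s => op.eval (s.reg y) (s.reg z) ≤ B ∧
      Q (s.setReg x (op.eval (s.reg y) (s.reg z)))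
  | .load x y, Q, s => Q (s.setReg x (s.mem (s.reg y)))
  | .store x y, Q, s => Q (s.setMem (s.reg x) (s.reg y))
  | .seq c d, Q, s => wp B c (wp B d Q) s
  | .ite x y c d, Q, s => (s.reg x < s.reg y → wp B c Q s) ∧ (¬ s.reg x < s.reg y → wp B d Q s)
  | .loop _ _ _, _, _ => False

/-- An upper bound for the number of steps of a program without loops. -/
def len : Program → ℕ
  | .seq c d => len c + len d
  | .ite _ _ c d => 1 + (len c + len d)
  | _ => 1

theorem Triple.of_wp {B : ℕ} {c : Program} {s : State} {Q : State → Prop} (h : wp B c Q s) :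
    Triple B c (len c) s Q := by
  induction c generalizing s Q with
  | skip => exact fun hs => ⟨s, 1, .skip s, by simp only [len]; omega, hs, h⟩
  | const x k =>
    intro hs
    have := Nat.size_le_size h.1
    exact ⟨_, _, .const s x k, by simp only [len]; omega, hs.setReg x h.1, h.2⟩
  | arith op x y z =>
    intro hs
    have h1 := Nat.size_le_size (hs.1 y)
    have h2 := Nat.size_le_size (hs.1 z)
    exact ⟨_, _, .arith s op x y z, by simp only [len]; omega, hs.setReg x h.1, h.2⟩
  | load x y =>
    intro hs
    have h1 := Nat.size_le_size (hs.1 y)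
    have h2 := Nat.size_le_size (hs.2 (s.reg y))
    exact ⟨_, _, .load s x y, by simp only [len]; omega, hs.setReg x (hs.2 _), h⟩
  | store x y =>
    intro hs
    have h1 := Nat.size_le_size (hs.1 y)
    have h2 := Nat.size_le_size (hs.1 x)
    exact ⟨_, _, .store s x y, by simp only [len]; omega, hs.setMem _ (hs.1 _), h⟩
  | seq c d hc hd => exact Triple.seq (hc h) fun s' h' => hd h'
  | ite x y c d hc hd =>
    intro hs
    have h1 := Nat.size_le_size (hs.1 y)
    have h2 := Nat.size_le_size (hs.1 x)
    by_cases hxy : s.reg x < s.reg y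
    · obtain ⟨s', t, he, ht, hb, hq⟩ := hc (h.1 hxy) hs
      exact ⟨s', _, .ite_true hxy he, by simp only [len, add_mul] at *; omega, hb, hq⟩
    · obtain ⟨s', t, he, ht, hb, hq⟩ := hd (h.2 hxy) hs
      exact ⟨s', _, .ite_false hxy he, by simp only [len, add_mul] at *; omega, hb, hq⟩
  | loop => exact h.elim

/-- A loop that makes `m - i` rounds, with the invariant `I i` before round `i`. -/
theorem Triple.loop_aux {B N : ℕ} {x y : ℕ} {c : Program} (I : ℕ → State → Prop) {m : ℕ}
    (hlt : ∀ i s, i < m → I i s → s.reg x < s.reg y ∧ Triple B c N s (I (i + 1)))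
    (hend : ∀ s, I m s → ¬ s.reg x < s.reg y) (k : ℕ) :
    ∀ i s, i + k = m → I i s → Triple B (.loop x y c) (k * (N + 1) + 1) s (I m) := by
  induction k with
  | zero =>
    intro i s hi h hs
    obtain rfl : i = m := by omega
    have h1 := Nat.size_le_size (hs.1 y)
    have h2 := Nat.size_le_size (hs.1 x)
    exact ⟨s, _, .loop_false (hend s h), by omega, hs, h⟩
  | succ k ih =>
    intro i s hi h hs
    have h1 := Nat.size_le_size (hs.1 y)
    have h2 := Nat.size_le_size (hs.1 x)
    obtain ⟨hxy, hc⟩ := hlt i s (by omega) h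
    obtain ⟨s', t, he, ht, hb, hq⟩ := hc hs
    obtain ⟨s'', t', he', ht', hb', hq'⟩ := ih (i + 1) s' (by omega) hq hb
    refine ⟨s'', _, .loop_true hxy he he', ?_, hb', hq'⟩
    simp only [add_mul, one_mul] at *
    omega

theorem Triple.loop {B N : ℕ} {x y : ℕ} {c : Program} (I : ℕ → State → Prop) (m : ℕ) {s : State}
    (h0 : I 0 s) (hlt : ∀ i s, i < m → I i s → s.reg x < s.reg y ∧ Triple B c N s (I (i + 1)))
    (hend : ∀ s, I m s → ¬ s.reg x < s.reg y) :
    Triple B (.loop x y c) (m * (N + 1) + 1) s (I m) :=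
  Triple.loop_aux I hlt hend m 0 s (by omega) h0

end RAM

namespace Makespan

open Finset

/-! ### Greedy reference assignment -/

/-- The rounded ratio of the two times of a job. -/
def ratio (P : ℕ) (a b : ℕ → ℕ) (j : ℕ) : ℕ := a j * (P * P) / b j

/-- State of the greedy algorithm that moves jobs to machine `0` by increasing ratio: `G` is the set
of jobs on machine `0`, the jobs of ratio below `r`, and those of ratio `r` and index below `i`,
have been treated, and `u` and `v` are the loads. -/
structure Greedy (n P : ℕ) (a b : ℕ → ℕ) (r i : ℕ) (G : Finset ℕ) (u v : ℕ) : Prop where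
  sub : G ⊆ range n
  zero : ∀ j < n, a j = 0 → j ∈ G
  pos : ∀ j ∈ G, 0 < a j → 0 < b j
  load_zero : u = ∑ j ∈ G, a j
  load_one : v = ∑ j ∈ range n \ G, b j
  gap : u ≤ v + 2 * P
  left : ∀ j < n, j ∉ G → 0 < b j → (ratio P a b j < r ∨ ratio P a b j = r ∧ j < i) → v ≤ u
  moved : ∀ j ∈ G, 0 < a j → ratio P a b j < r ∨ ratio P a b j = r ∧ j < i
  ord : ∀ j ∈ G, ∀ k < n, k ∉ G → 0 < b k → 0 < a j → ratio P a b j ≤ ratio P a b k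

variable {n P : ℕ} {a b : ℕ → ℕ}

theorem ratio_pos (hb : ∀ j, b j ≤ P) {j : ℕ} (haj : 0 < a j) (hbj : 0 < b j) :
    0 < ratio P a b j := by
  have := hb j
  refine Nat.div_pos ?_ hbj
  nlinarith [Nat.mul_le_mul haj (Nat.mul_le_mul this (hbj.trans_le this))]

/-- Distinct fractions with denominators at most `P` differ by at least `1 / P ^ 2`, so after
scaling by `P * P` rounding down cannot merge them. Integer ratios therefore suffice for the order.
-/
theorem ratio_lt_of_mul_lt (hb : ∀ j, b j ≤ P) {j k : ℕ} (hbj : 0 < b j) (hbk : 0 < b k)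
    (h : a k * b j < a j * b k) : ratio P a b k < ratio P a b j := by
  unfold ratio
  rw [← Nat.succ_le_iff, Nat.le_div_iff_mul_le hbj, Nat.succ_eq_add_one]
  refine Nat.le_of_mul_le_mul_right ?_ hbk
  have h1 := Nat.div_mul_le_self (a k * (P * P)) (b k)
  set q := a k * (P * P) / b k
  calc (q + 1) * b j * b k = q * b k * b j + b j * b k := by ring
    _ ≤ a k * (P * P) * b j + P * P := by
      gcongr
      · exact hb j
      · exact hb k
    _ = (a k * b j + 1) * (P * P) := by ring
    _ ≤ a j * b k * (P * P) := by gcongr; omega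
    _ = a j * (P * P) * b k := by ring

/-- The passes start at ratio 1. Ratio 0 occurs only if `a j = 0`, when the job is on machine 0 from
the outset, or if `b j = 0`, by division by zero, when a job with `0 < a j` rightly stays on machine
1. -/
theorem Greedy.init (hb : ∀ j, b j ≤ P) : Greedy n P a b 1 0 {j ∈ range n | a j = 0} 0
    (∑ j ∈ range n, if 0 < a j then b j else 0) where
  sub := filter_subset _ _
  zero := by simp +contextual
  pos := by simp +contextual
  load_zero := (sum_eq_zero (by simp)).symm
  load_one := by
    rw [← sum_filter]
    congr 1
    ext j
    simp only [mem_filter, mem_range, mem_sdiff]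
    omega
  gap := by omega
  left := by
    intro j hj hG hbj h
    have haj : 0 < a j := by
      simp only [mem_filter, mem_range, not_and] at hG
      have := hG hj
      omega
    have := ratio_pos hb haj hbj
    omega
  moved := by simp +contextual
  ord := by
    intro j hj k _ _ _ haj
    simp only [mem_filter] at hj
    omega

variable {r i u v : ℕ} {G : Finset ℕ}

theorem Greedy.next_ratio (h : Greedy n P a b r n G u v) : Greedy n P a b (r + 1) 0 G u v where
  sub := h.sub
  zero := h.zero
  pos := h.pos
  load_zero := h.load_zero
  load_one := h.load_one
  gap := h.gap
  left := fun j hj hG hbj hr => h.left j hj hG hbj (by omega)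
  moved := fun j hj haj => by have := h.moved j hj haj; omega
  ord := h.ord

theorem Greedy.skip (h : Greedy n P a b r i G u v) (hi : ratio P a b i = r → v ≤ u) :
    Greedy n P a b r (i + 1) G u v where
  sub := h.sub
  zero := h.zero
  pos := h.pos
  load_zero := h.load_zero
  load_one := h.load_one
  gap := h.gap
  left := fun j hj hG hbj hr => by
    rcases eq_or_ne j i with rfl | hji
    · rcases hr with hr | hr
      · exact h.left j hj hG hbj (Or.inl hr)
      · exact hi hr.1
    · exact h.left j hj hG hbj (by omega)
  moved := fun j hj haj => by have := h.moved j hj haj; omega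
  ord := h.ord

theorem Greedy.notMem (h : Greedy n P a b r i G u v) (hr : 0 < r) (hi : ratio P a b i = r) :
    i ∉ G := by
  intro hG
  rcases Nat.eq_zero_or_pos (a i) with ha | ha
  · simp only [ratio, ha, zero_mul, Nat.zero_div] at hi
    omega
  · have := h.moved i hG ha
    omega

theorem Greedy.le_load (h : Greedy n P a b r i G u v) (hr : 0 < r) (hin : i < n)
    (hi : ratio P a b i = r) : b i ≤ v := by
  rw [h.load_one]
  exact single_le_sum (f := b) (fun _ _ => Nat.zero_le _)
    (mem_sdiff.2 ⟨mem_range.2 hin, h.notMem hr hi⟩)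

/-- As `u < v`, the field `left` says that no treated job with `0 < b j` was left behind, which
preserves the order of ratios. One move shifts the difference of the loads by at most `2 * P`, which
is the origin of `gap`. -/
theorem Greedy.move (ha : ∀ j, a j ≤ P) (hb : ∀ j, b j ≤ P) (h : Greedy n P a b r i G u v)
    (hr : 0 < r) (hin : i < n) (hi : ratio P a b i = r) (huv : u < v) :
    Greedy n P a b r (i + 1) (insert i G) (u + a i) (v - b i) where
  sub := insert_subset (mem_range.2 hin) h.sub
  zero := fun j hj h0 => mem_insert_of_mem (h.zero j hj h0)
  pos := by
    intro j hj haj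
    rcases mem_insert.1 hj with rfl | hj
    · by_contra hb0
      obtain hb0 : b j = 0 := by omega
      simp only [ratio, hb0, Nat.div_zero] at hi
      omega
    · exact h.pos j hj haj
  load_zero := by rw [sum_insert (h.notMem hr hi), h.load_zero, add_comm]
  load_one := by
    have hmem : i ∈ range n \ G := mem_sdiff.2 ⟨mem_range.2 hin, h.notMem hr hi⟩
    rw [h.load_one, ← add_sum_erase _ _ hmem, Nat.add_sub_cancel_left]
    congr 1
    ext j
    simp only [mem_erase, mem_sdiff, mem_insert]
    tauto
  gap := by
    have := ha i
    have := hb i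
    have := h.le_load hr hin hi
    omega
  left := by
    intro j hj hG hbj hr'
    rw [mem_insert, not_or] at hG
    have := h.left j hj hG.2 hbj (by omega)
    omega
  moved := by
    intro j hj haj
    rcases mem_insert.1 hj with rfl | hj
    · omega
    · have := h.moved j hj haj
      omega
  ord := by
    intro j hj k hk hkG hbk haj
    rw [mem_insert, not_or] at hkG
    rcases mem_insert.1 hj with rfl | hj
    · by_contra hlt
      have := h.left k hk hkG.2 hbk (by omega)
      omega
    · exact h.ord j hj k hk hkG.2 hbk haj

/-- A balanced assignment (`G` is the set of jobs on machine `0`) that respects the order of the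
ratios of the two times. -/
structure Reference (n P : ℕ) (a b : ℕ → ℕ) (G : Finset ℕ) : Prop where
  sub : G ⊆ range n
  pos_left : ∀ k < n, k ∉ G → 0 < a k
  pos_right : ∀ j ∈ G, 0 < a j → 0 < b j
  le : ∑ j ∈ range n \ G, b j ≤ ∑ j ∈ G, a j
  gap : ∑ j ∈ G, a j ≤ ∑ j ∈ range n \ G, b j + 2 * P
  ord : ∀ j ∈ G, ∀ k < n, k ∉ G → a j * b k ≤ a k * b j

theorem Greedy.reference (ha : ∀ j, a j ≤ P) (hb : ∀ j, b j ≤ P)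
    (h : Greedy n P a b (P * P * P + 1) 0 G u v) : Reference n P a b G where
  sub := h.sub
  pos_left := fun k hk hG => Nat.pos_of_ne_zero fun h0 => hG (h.zero k hk h0)
  pos_right := h.pos
  le := by
    rw [← h.load_zero, ← h.load_one]
    by_cases hj : ∃ j < n, j ∉ G ∧ 0 < b j
    · obtain ⟨j, hj, hG, hbj⟩ := hj
      refine h.left j hj hG hbj (Or.inl ?_)
      -- No ratio exceeds `P * P * P`, so every job has been treated.
      rw [Nat.lt_succ_iff]
      refine (Nat.div_le_self _ _).trans ?_
      rw [mul_assoc]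
      exact Nat.mul_le_mul_right _ (ha j)
    · push Not at hj
      rw [h.load_one, sum_eq_zero]
      · omega
      · intro j hj'
        rw [mem_sdiff, mem_range] at hj'
        exact Nat.le_zero.1 (hj j hj'.1 hj'.2)
  gap := by rw [← h.load_zero, ← h.load_one]; exact h.gap
  ord := by
    intro j hj k hk hG
    by_contra! hlt
    have haj : 0 < a j := Nat.pos_of_ne_zero fun h0 => by simp [h0] at hlt
    have hbk : 0 < b k := Nat.pos_of_ne_zero fun h0 => by simp [h0] at hlt
    have h1 := h.ord j hj k hk hG hbk haj
    have h2 := ratio_lt_of_mul_lt (a := a) hb (h.pos j hj haj) hbk hlt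
    omega

/-! ### Proximity of optimal assignments to the reference -/

/-- The makespan of the assignment of the jobs in `S` to machine `0` and the others to
machine `1`. -/
def cost (n : ℕ) (a b : ℕ → ℕ) (S : Finset ℕ) : ℕ := max (∑ j ∈ S, a j) (∑ j ∈ range n \ S, b j)

theorem exists_subset_card_of_values {A : Finset ℕ} {f : ℕ → ℕ} (hf : ∀ j ∈ A, 0 < f j ∧ f j ≤ P)
    (hP : 0 < P) (hA : P * P ≤ #A) :
    ∃ v, 0 < v ∧ v ≤ P ∧ P ≤ #{j ∈ A | f j = v} := by
  obtain ⟨v, hv, h⟩ := exists_le_card_fiber_of_mul_le_card_of_maps_to (s := A) (t := Icc 1 P)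
    (f := f) (n := P) (fun j hj => mem_Icc.2 (hf j hj)) ⟨1, mem_Icc.2 ⟨le_rfl, hP⟩⟩ (by simpa)
  rw [mem_Icc] at hv
  exact ⟨v, hv.1, hv.2, h⟩

theorem sum_union_sdiff {S X Y : Finset ℕ} (hX : X ⊆ S) (hY : Disjoint Y S) (f : ℕ → ℕ) :
    ∑ j ∈ S \ X ∪ Y, f j + ∑ j ∈ X, f j = ∑ j ∈ S, f j + ∑ j ∈ Y, f j := by
  rw [sum_union (hY.symm.mono_left sdiff_subset), ← sum_sdiff hX]
  ring

/-- Among the optimal assignments, one that is nearest to `G`. -/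
theorem exists_nearest (n : ℕ) (a b : ℕ → ℕ) (G : Finset ℕ) : ∃ S ⊆ range n,
    (∀ T ⊆ range n, cost n a b S ≤ cost n a b T) ∧
    ∀ T ⊆ range n, cost n a b T ≤ cost n a b S → #(G \ S) + #(S \ G) ≤ #(G \ T) + #(T \ G) := by
  obtain ⟨S₀, hS₀, hmin⟩ := exists_min_image (range n).powerset (cost n a b) ⟨∅, by simp⟩
  obtain ⟨S, hS, hmin'⟩ := exists_min_image
    {S ∈ (range n).powerset | cost n a b S ≤ cost n a b S₀}
    (fun S => #(G \ S) + #(S \ G)) ⟨S₀, by simpa using hS₀⟩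
  simp only [mem_filter, mem_powerset] at *
  exact ⟨S, hS.1, fun T hT => hS.2.trans (hmin T hT),
    fun T hT hTS => hmin' T ⟨hT, hTS.trans hS.2⟩⟩

/-- A nearest optimal assignment cannot be moved towards `G` without loss. -/
theorem no_exchange {S X Y : Finset ℕ} (hG : G ⊆ range n) (hS : S ⊆ range n)
    (hnear : ∀ T ⊆ range n, cost n a b T ≤ cost n a b S →
      #(G \ S) + #(S \ G) ≤ #(G \ T) + #(T \ G))
    (hX : X ⊆ S \ G) (hY : Y ⊆ G \ S) (hne : 0 < #X + #Y)
    (h0 : ∑ j ∈ Y, a j ≤ ∑ j ∈ X, a j) (h1 : ∑ j ∈ X, b j ≤ ∑ j ∈ Y, b j) : False := by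
  have hXS : X ⊆ S := hX.trans sdiff_subset
  have hYS : Disjoint Y S := disjoint_of_subset_left hY sdiff_disjoint
  have hT : S \ X ∪ Y ⊆ range n :=
    union_subset (sdiff_subset.trans hS) ((hY.trans sdiff_subset).trans hG)
  have e0 := sum_union_sdiff hXS hYS a
  have e1 := sum_union_sdiff hXS hYS b
  have e2 := sum_sdiff (f := b) hT
  have e3 := sum_sdiff (f := b) hS
  have hle := hnear _ hT (by unfold cost; omega)
  have c1 : #(G \ (S \ X ∪ Y)) ≤ #(G \ S) - #Y := by
    rw [← card_sdiff_of_subset hY]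
    refine card_le_card fun j => ?_
    have := @hX j
    simp only [mem_sdiff, mem_union] at *
    tauto
  have c2 : #((S \ X ∪ Y) \ G) ≤ #(S \ G) - #X := by
    rw [← card_sdiff_of_subset hX]
    refine card_le_card fun j => ?_
    have := @hY j
    simp only [mem_sdiff, mem_union] at *
    tauto
  have := card_le_card hX
  have := card_le_card hY
  omega

theorem sum_le_of_card {A : Finset ℕ} (ha : ∀ j, a j ≤ P) {m : ℕ} (h : #A ≤ m) :
    ∑ j ∈ A, a j ≤ m * P :=
  (sum_le_card_nsmul A a P fun j _ => ha j).trans (Nat.mul_le_mul_right P h)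

/-- Some optimal assignment is close to the reference. -/
theorem Reference.exists_near (hP : 0 < P) (ha : ∀ j, a j ≤ P) (hb : ∀ j, b j ≤ P)
    (h : Reference n P a b G) : ∃ S ⊆ range n, (∀ T ⊆ range n, cost n a b S ≤ cost n a b T) ∧
      ∑ j ∈ G \ S, a j ≤ 3 * P ^ 4 ∧ ∑ j ∈ S \ G, a j ≤ 3 * P ^ 4 := by
  obtain ⟨S, hS, hopt, hnear⟩ := exists_nearest n a b G
  refine ⟨S, hS, hopt, ?_⟩
  -- A job with `a j = 0` could join machine 0 for free and bring `S` nearer to `G`.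
  have hA : ∀ j ∈ G \ S, 0 < a j := by
    intro j hj
    by_contra h0
    exact no_exchange h.sub hS hnear (empty_subset _) (singleton_subset_iff.2 hj) (by simp)
      (by simp; omega) (by simp)
  have hA' : ∀ j ∈ G \ S, 0 < b j := fun j hj => h.pos_right j (mem_sdiff.1 hj).1 (hA j hj)
  have hB : ∀ j ∈ S \ G, 0 < a j := fun j hj =>
    h.pos_left j (mem_range.1 (hS (mem_sdiff.1 hj).1)) (mem_sdiff.1 hj).2
  have hcard : #(G \ S) < P * P ∨ #(S \ G) < P * P := by
    by_contra! hc
    obtain ⟨v, hv, hvP, hvc⟩ := exists_subset_card_of_values (fun j hj => ⟨hA j hj, ha j⟩) hP hc.1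
    obtain ⟨w, hw, hwP, hwc⟩ := exists_subset_card_of_values (fun j hj => ⟨hB j hj, ha j⟩) hP hc.2
    obtain ⟨Y, hY, hYc⟩ := exists_subset_card_eq (hwP.trans hvc)
    obtain ⟨X, hX, hXc⟩ := exists_subset_card_eq (hvP.trans hwc)
    have sY : ∑ j ∈ Y, a j = w * v := by
      rw [sum_congr rfl fun j hj => (mem_filter.1 (hY hj)).2]
      simp [hYc]
    have sX : ∑ j ∈ X, a j = v * w := by
      rw [sum_congr rfl fun j hj => (mem_filter.1 (hX hj)).2]
      simp [hXc]
    refine no_exchange h.sub hS hnear (hX.trans (filter_subset _ _)) (hY.trans (filter_subset _ _))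
      (by omega) (by rw [sX, sY, mul_comm]) ?_
    -- Summing the ratio inequality over all pairs gives `w * v * b(X) ≤ v * w * b(Y)`.
    have key : ∑ j ∈ Y, ∑ k ∈ X, v * b k ≤ ∑ j ∈ Y, ∑ k ∈ X, w * b j := by
      refine sum_le_sum fun j hj => sum_le_sum fun k hk => ?_
      have hj := mem_filter.1 (hY hj)
      have hk := mem_filter.1 (hX hk)
      have hk' := mem_sdiff.1 hk.1
      have := h.ord j (mem_sdiff.1 hj.1).1 k (mem_range.1 (hS hk'.1)) hk'.2
      rwa [hj.2, hk.2] at this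
    simp only [sum_const, ← mul_sum, smul_eq_mul, hXc, hYc] at key
    rw [← mul_assoc, ← mul_assoc, mul_comm w v] at key
    exact Nat.le_of_mul_le_mul_left key (Nat.mul_pos hv hw)
  have hGS := hopt G h.sub
  have hle := h.le
  have hgap := h.gap
  unfold cost at hGS
  have e0 : ∑ j ∈ G, a j + ∑ j ∈ S \ G, a j = ∑ j ∈ S, a j + ∑ j ∈ G \ S, a j := by
    rw [← sum_sdiff (f := a) (inter_subset_left : G ∩ S ⊆ G),
      ← sum_sdiff (f := a) (inter_subset_right : G ∩ S ⊆ S), sdiff_inter_self_left,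
      sdiff_inter_self_right]
    ring
  have e1 : ∑ j ∈ range n \ S, b j + ∑ j ∈ S \ G, b j
      = ∑ j ∈ range n \ G, b j + ∑ j ∈ G \ S, b j := by
    have f0 : ∑ j ∈ G, b j + ∑ j ∈ S \ G, b j = ∑ j ∈ S, b j + ∑ j ∈ G \ S, b j := by
      rw [← sum_sdiff (f := b) (inter_subset_left : G ∩ S ⊆ G),
        ← sum_sdiff (f := b) (inter_subset_right : G ∩ S ⊆ S), sdiff_inter_self_left,
        sdiff_inter_self_right]
      ring
    have f1 := sum_sdiff (f := b) hS
    have f2 := sum_sdiff (f := b) h.sub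
    omega
  have p1 : P * P * P ≤ P ^ 4 := by
    calc P * P * P = P ^ 3 := by ring
      _ ≤ P ^ 4 := Nat.pow_le_pow_right hP (by norm_num)
  have p2 : P * P ≤ P ^ 4 := by
    calc P * P = P ^ 2 := by ring
      _ ≤ P ^ 4 := Nat.pow_le_pow_right hP (by norm_num)
  rcases hcard with hc | hc
  -- Optimality and `h.le` give `a(S) ≤ a(G)`, so `a(S \ G) ≤ a(G \ S) ≤ P ^ 3`.
  · have h1 := sum_le_of_card ha hc.le
    omega
  -- Here the load of machine 1 under `S` is at most `a(G)`, hence at most its load under `G` plus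
  -- `2 * P`. This bounds `b(G \ S)`, and with it the number of jobs there, since each has `0 < b
  -- j`.
  · have h1 := sum_le_of_card ha hc.le
    have h2 := sum_le_of_card hb hc.le
    have h3 : #(G \ S) ≤ ∑ j ∈ G \ S, b j := by
      simpa using card_nsmul_le_sum (G \ S) b 1 fun j hj => hA' j hj
    have h4 : #(G \ S) ≤ 2 * P + P * P * P := by omega
    have h5 := sum_le_of_card ha h4
    have h6 : (2 * P + P * P * P) * P = 2 * (P * P) + P ^ 4 := by ring
    omega

end Makespan

namespace Makespan

open Finset

/-! ### Dynamic program over the deviation from the reference -/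

/-- Row of the dynamic program for the last `k` of `n` jobs. The index `x` is `4 * Q` plus the
deviation of the load of machine `0` from the reference, to which job `j` contributes `c j`. The
entry is one plus the largest total time on machine `1` of jobs on machine `0`, and `0` if there
is no assignment within the window. -/
def table (n Q : ℕ) (a b c : ℕ → ℕ) : ℕ → ℕ → ℕ
  | 0, x => if x = 4 * Q then 1 else 0
  | k + 1, x =>
    if Q ≤ x ∧ x < 8 * Q then
      if 0 < table n Q a b c k (x + c (n - (k + 1)) - a (n - (k + 1))) then
        max (table n Q a b c k (x + c (n - (k + 1))))
          (table n Q a b c k (x + c (n - (k + 1)) - a (n - (k + 1))) + b (n - (k + 1)))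
      else table n Q a b c k (x + c (n - (k + 1)))
    else 0

variable {n P Q : ℕ} {a b c : ℕ → ℕ}

theorem table_le (hb : ∀ j, b j ≤ P) (k x : ℕ) : table n Q a b c k x ≤ 1 + k * P := by
  induction k generalizing x with
  | zero => unfold table; split <;> omega
  | succ k ih =>
    have := ih (x + c (n - (k + 1)))
    have := ih (x + c (n - (k + 1)) - a (n - (k + 1)))
    have := hb (n - (k + 1))
    rw [table, add_mul]
    split
    · split <;> omega
    · omega

/-- The path of `S` never leaves the window: suffix deviations of at most `3 * Q` around the centre
`4 * Q` keep the index between `Q` and `7 * Q`. -/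
theorem le_table {S : Finset ℕ} (hQ : 0 < Q)
    (h1 : ∀ m, ∑ i ∈ Ico m n, c i ≤ ∑ i ∈ Ico m n, (if i ∈ S then a i else 0) + 3 * Q)
    (h2 : ∀ m, ∑ i ∈ Ico m n, (if i ∈ S then a i else 0) ≤ ∑ i ∈ Ico m n, c i + 3 * Q)
    {k : ℕ} (hk : k ≤ n) :
    1 + ∑ i ∈ Ico (n - k) n, (if i ∈ S then b i else 0) ≤ table n Q a b c k
      (4 * Q + ∑ i ∈ Ico (n - k) n, (if i ∈ S then a i else 0) - ∑ i ∈ Ico (n - k) n, c i) := by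
  induction k with
  | zero => simp [table]
  | succ k ih =>
    have ih := ih (by omega)
    have e1 := h1 (n - (k + 1))
    have e2 := h2 (n - (k + 1))
    have e3 := h1 (n - k)
    have hs : ∀ f : ℕ → ℕ, ∑ i ∈ Ico (n - (k + 1)) n, f i
        = f (n - (k + 1)) + ∑ i ∈ Ico (n - k) n, f i := fun f => by
      rw [sum_eq_sum_Ico_succ_bot (by omega), show n - (k + 1) + 1 = n - k by omega]
    rw [hs, hs] at e1 e2
    rw [hs, hs, hs, table]
    have hwin : ∀ s u v w : ℕ, v + w ≤ s + u + 3 * Q → s + u ≤ v + w + 3 * Q →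
        Q ≤ 4 * Q + (s + u) - (v + w) ∧ 4 * Q + (s + u) - (v + w) < 8 * Q := by omega
    rw [if_pos (hwin _ _ _ _ e1 e2)]
    clear hs hwin
    generalize n - (k + 1) = j at *
    generalize ∑ i ∈ Ico (n - k) n, (if i ∈ S then a i else 0) = u at *
    generalize ∑ i ∈ Ico (n - k) n, c i = w at *
    by_cases hj : j ∈ S
    · simp only [hj, if_true] at *
      rw [show 4 * Q + (a j + u) - (c j + w) + c j - a j = 4 * Q + u - w by omega, if_pos (by omega)]
      have := le_max_right (table n Q a b c k (4 * Q + (a j + u) - (c j + w) + c j))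
        (table n Q a b c k (4 * Q + u - w) + b j)
      omega
    · simp only [hj, if_false] at *
      rw [show 4 * Q + (0 + u) - (c j + w) + c j = 4 * Q + u - w by omega]
      split
      · have := le_max_left (table n Q a b c k (4 * Q + u - w))
          (table n Q a b c k (4 * Q + u - w - a j) + b j)
        omega
      · omega

/-- State of the reconstruction of an assignment for the entry `z` of the last row: `S` is the set
of those of the first `j` jobs that are on machine `0`, and `x` is the entry reached. -/
structure Trace (n Q : ℕ) (a b c : ℕ → ℕ) (z j x : ℕ) (S : Finset ℕ) : Prop where
  sub : S ⊆ range j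
  index : x + ∑ i ∈ S, a i = z + ∑ i ∈ range j, c i
  value : table n Q a b c (n - j) x + ∑ i ∈ S, b i = table n Q a b c n z
  pos : 0 < table n Q a b c (n - j) x

variable {z j x : ℕ} {S : Finset ℕ}

theorem Trace.init (h : 0 < table n Q a b c n z) : Trace n Q a b c z 0 z ∅ :=
  ⟨by simp, by simp, by simp, by simpa⟩

theorem Trace.table_eq (h : Trace n Q a b c z j x S) (hj : j < n) :
    (Q ≤ x ∧ x < 8 * Q) ∧ table n Q a b c (n - j) x =
      if 0 < table n Q a b c (n - (j + 1)) (x + c j - a j) then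
        max (table n Q a b c (n - (j + 1)) (x + c j))
          (table n Q a b c (n - (j + 1)) (x + c j - a j) + b j)
      else table n Q a b c (n - (j + 1)) (x + c j) := by
  have hp := h.pos
  have e : n - j = n - (j + 1) + 1 := by omega
  have e' : n - (n - (j + 1) + 1) = j := by omega
  rw [e, table, e'] at hp ⊢
  by_cases hx : Q ≤ x ∧ x < 8 * Q
  · exact ⟨hx, if_pos hx⟩
  · rw [if_neg hx] at hp
    omega

/-- Since `a j ≤ Q ≤ x`, the truncated subtraction in the index is exact. -/
theorem Trace.take (h : Trace n Q a b c z j x S) (hj : j < n) (ha : a j ≤ Q)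
    (h1 : 0 < table n Q a b c (n - (j + 1)) (x + c j - a j))
    (h2 : table n Q a b c (n - j) x ≤ table n Q a b c (n - (j + 1)) (x + c j - a j) + b j) :
    Trace n Q a b c z (j + 1) (x + c j - a j) (insert j S) := by
  obtain ⟨hx, ht⟩ := h.table_eq hj
  have hi := h.index
  have hv := h.value
  have hn : j ∉ S := fun hjS => by simpa using h.sub hjS
  rw [if_pos h1] at ht
  refine ⟨?_, ?_, ?_, h1⟩
  · rw [range_add_one]
    exact insert_subset_insert _ h.sub
  · rw [sum_insert hn, sum_range_succ]
    omega
  · rw [sum_insert hn]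
    omega

theorem Trace.leave (h : Trace n Q a b c z j x S) (hj : j < n)
    (h1 : 0 < table n Q a b c (n - (j + 1)) (x + c j - a j) →
      table n Q a b c (n - (j + 1)) (x + c j - a j) + b j < table n Q a b c (n - j) x) :
    Trace n Q a b c z (j + 1) (x + c j) S := by
  obtain ⟨hx, ht⟩ := h.table_eq hj
  have hi := h.index
  have hv := h.value
  have hp := h.pos
  have e : table n Q a b c (n - j) x = table n Q a b c (n - (j + 1)) (x + c j) := by
    split at ht <;> omega
  refine ⟨h.sub.trans (range_subset_range.2 (by omega)), ?_, by omega, by omega⟩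
  rw [sum_range_succ]
  omega

theorem Trace.final (h : Trace n Q a b c z n x S) :
    ∑ i ∈ S, a i + 4 * Q = z + ∑ i ∈ range n, c i ∧ ∑ i ∈ S, b i + 1 = table n Q a b c n z := by
  have hi := h.index
  have hv := h.value
  have hp := h.pos
  rw [Nat.sub_self, table] at hv hp
  split at hp
  · rw [if_pos (by assumption)] at hv
    omega
  · omega

/-- The makespan that an entry of the last row stands for. -/
def entryValue (n Q : ℕ) (a b c : ℕ → ℕ) (z : ℕ) : ℕ :=
  max (∑ i ∈ range n, c i + z - 4 * Q) (∑ i ∈ range n, b i + 1 - table n Q a b c n z)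

theorem Trace.cost_eq (h : Trace n Q a b c z n x S) : cost n a b S = entryValue n Q a b c z := by
  obtain ⟨h1, h2⟩ := h.final
  have := sum_sdiff (f := b) h.sub
  unfold cost entryValue
  congr 1 <;> omega

/-- The last row of the dynamic program contains the optimal makespan. -/
theorem Reference.exists_index {G : Finset ℕ} (hP : 0 < P) (ha : ∀ j, a j ≤ P)
    (hb : ∀ j, b j ≤ P) (h : Reference n P a b G) (hc : ∀ j, c j = if j ∈ G then a j else 0)
    (hQ : Q = P ^ 4) : ∃ z, Q ≤ z ∧ z < 8 * Q ∧ 0 < table n Q a b c n z ∧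
      ∀ T ⊆ range n, entryValue n Q a b c z ≤ cost n a b T := by
  obtain ⟨S, hS, hopt, h1, h2⟩ := h.exists_near hP ha hb
  rw [← hQ] at h1 h2
  have hQ0 : 0 < Q := hQ ▸ Nat.pow_pos hP
  -- On any suffix, `U` exceeds `V` by no more than the whole load of `U \ V`.
  have key : ∀ (U V : Finset ℕ), ∑ j ∈ U \ V, a j ≤ 3 * Q → ∀ m,
      ∑ i ∈ Ico m n, (if i ∈ U then a i else 0)
        ≤ ∑ i ∈ Ico m n, (if i ∈ V then a i else 0) + 3 * Q := by
    intro U V hUV m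
    calc ∑ i ∈ Ico m n, (if i ∈ U then a i else 0)
        ≤ ∑ i ∈ Ico m n, ((if i ∈ V then a i else 0) + if i ∈ U \ V then a i else 0) := by
          refine sum_le_sum fun i _ => ?_
          by_cases hU : i ∈ U <;> by_cases hV : i ∈ V <;> simp [hU, hV]
      _ = ∑ i ∈ Ico m n, (if i ∈ V then a i else 0)
          + ∑ i ∈ Ico m n, if i ∈ U \ V then a i else 0 := sum_add_distrib
      _ ≤ _ := by
          refine Nat.add_le_add_left (le_trans ?_ hUV) _
          rw [← sum_filter]
          exact sum_le_sum_of_subset fun i hi => (mem_filter.1 hi).2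
  obtain rfl : c = fun j => if j ∈ G then a j else 0 := funext hc
  have k1 := key G S h1
  have k2 := key S G h2
  have hT := le_table (b := b) hQ0 k1 k2 le_rfl
  have e1 := k1 0
  have e2 := k2 0
  simp only [Nat.sub_self] at hT
  have hsub : ∀ f : ℕ → ℕ, ∑ i ∈ Ico 0 n, (if i ∈ S then f i else 0) = ∑ i ∈ S, f i := by
    intro f
    rw [← sum_filter]
    refine sum_congr ?_ fun _ _ => rfl
    ext i
    simpa using fun hi => mem_range.1 (hS hi)
  rw [hsub] at e1 e2
  rw [hsub, hsub] at hT
  -- The witness is the index of the total deviation of `S`, taken from `hT`.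
  refine ⟨_, ?_, ?_, lt_of_lt_of_le (by omega) hT, fun T hTn => le_trans ?_ (hopt T hTn)⟩
  · omega
  · omega
  · unfold entryValue cost
    beta_reduce
    have e3 := sum_sdiff (f := b) hS
    rw [range_eq_Ico] at *
    refine max_le_max ?_ ?_ <;> omega

end Makespan

/-! ### Effect of single writes on the state -/

namespace RAM

theorem State.setReg_reg (s : State) (x v y : ℕ) :
    (s.setReg x v).reg y = if y = x then v else s.reg y := by
  simp [State.setReg, Function.update_apply]

theorem State.setReg_mem (s : State) (x v : ℕ) : (s.setReg x v).mem = s.mem := rfl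

theorem State.setMem_reg (s : State) (a v : ℕ) : (s.setMem a v).reg = s.reg := rfl

theorem State.setMem_mem (s : State) (a v y : ℕ) :
    (s.setMem a v).mem y = if y = a then v else s.mem y := by
  simp [State.setMem, Function.update_apply]

/-- Sequential composition of a list of programs. -/
def block : List Program → Program
  | [] => .skip
  | c :: l => .seq c (block l)

end RAM

namespace Makespan

open Finset RAM RAM.Program RAM.Op

/-! ### The program: reading the instance -/

/-- Load the times of job `reg 8` into the registers `12` and `13`. -/
def loadJob (l : List Program) : Program :=
  block (arith add 11 8 8 :: Program.load 12 11 :: arith add 11 11 1 :: Program.load 13 11 :: l)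

/-- Registers: `0` the number of jobs, `1` the number one, `2` the largest time, `3` the total time
on machine `1`, `4` this total for the jobs with a positive time on machine `0`. -/
def scanBody : Program :=
  loadJob [arith add 3 3 13, ite 2 12 (arith add 2 12 10) skip, ite 2 13 (arith add 2 13 10) skip,
    ite 10 12 (arith add 4 4 13) skip, arith add 8 8 1]

structure ScanInv (n M : ℕ) (m : ℕ → ℕ) (a b : ℕ → ℕ) (i : ℕ) (s : State) : Prop where
  mem : s.mem = m
  r0 : s.reg 0 = n
  r1 : s.reg 1 = 1
  r3 : s.reg 3 = ∑ j ∈ range i, b j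
  r4 : s.reg 4 = ∑ j ∈ range i, if 0 < a j then b j else 0
  r5 : s.reg 5 = 0
  r8 : s.reg 8 = i
  r10 : s.reg 10 = 0
  pos : 0 < s.reg 2
  le : s.reg 2 ≤ M
  max : ∀ j < i, a j ≤ s.reg 2 ∧ b j ≤ s.reg 2

/-- The memory `m` holds the times of the jobs. -/
structure Input (n : ℕ) (a b : ℕ → ℕ) (m : ℕ → ℕ) : Prop where
  left : ∀ j < n, m (j + j) = a j
  right : ∀ j < n, m (j + j + 1) = b j

theorem sum_range_le {M : ℕ} {f : ℕ → ℕ} (hf : ∀ j, f j ≤ M) (n : ℕ) :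
    ∑ j ∈ range n, f j ≤ n * M := by
  simpa using sum_le_card_nsmul (range n) f M fun j _ => hf j

theorem scanBody_spec {n M B : ℕ} {m a b : ℕ → ℕ} (hm : Input n a b m) (ha : ∀ j, a j ≤ M)
    (hb : ∀ j, b j ≤ M) (hB : n * M + 2 * n + M ≤ B) (i : ℕ) (s : State) (hi : i < n)
    (h : ScanInv n M m a b i s) :
    Triple B scanBody (len scanBody) s (ScanInv n M m a b (i + 1)) := by
  have e1 : ∀ f : ℕ → ℕ, (∀ j, f j ≤ M) → ∑ j ∈ range i, f j + f i ≤ n * M := by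
    intro f hf
    rw [← sum_range_succ]
    exact (sum_range_le hf _).trans (Nat.mul_le_mul_right _ hi)
  have s1 := e1 b hb
  have s2 := e1 (fun j => if 0 < a j then b j else 0) fun j => by have := hb j; split <;> omega
  have hai := ha i
  have hbi := hb i
  have hp := h.pos
  have hl := h.le
  have hmax : ∀ q, s.reg 2 ≤ q → a i ≤ q → b i ≤ q → ∀ j < i + 1, a j ≤ q ∧ b j ≤ q := by
    intro q h1 h2 h3 j hj
    rcases Nat.lt_succ_iff_lt_or_eq.1 hj with hj | rfl
    · have := h.max j hj
      omega
    · exact ⟨h2, h3⟩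
  apply Triple.of_wp
  simp only [scanBody, loadJob, block, wp, State.setReg_reg, State.setReg_mem, Op.eval,
    Nat.reduceEqDiff, if_true, if_false, h.r1, h.r3, h.r4, h.r8, h.r10, h.mem,
    hm.left i hi, hm.right i hi]
  refine ⟨by omega, by omega, by omega, ?_⟩
  repeat' (first | apply And.intro | intro _)
  any_goals omega
  all_goals constructor
  all_goals simp only [State.setReg_reg, State.setReg_mem, Nat.reduceEqDiff, if_true, if_false,
    h.r0, h.r1, h.r3, h.r4, h.r5, h.r10, h.mem, sum_range_succ]
  all_goals first
    | omega
    | split <;> omega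
    | exact hmax _ (by omega) (by omega) (by omega)

/-- Read the instance. -/
def scan : Program := seq (seq (const 1 1) (const 2 1)) (loop 8 0 scanBody)

theorem scan_spec {n M B : ℕ} {a b : ℕ → ℕ} {s : State} (hs0 : s.reg 0 = n)
    (hs : ∀ x, x ≠ 0 → s.reg x = 0) (hm : Input n a b s.mem) (ha : ∀ j, a j ≤ M)
    (hb : ∀ j, b j ≤ M) (hM : 0 < M) (hB : n * M + 2 * n + M ≤ B) :
    Triple B scan (n * 40 + 40) s (ScanInv n M s.mem a b n) := by
  have h1 : Triple B (.seq (const 1 1) (const 2 1)) 2 s (ScanInv n M s.mem a b 0) := by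
    apply Triple.of_wp
    simp only [wp]
    refine ⟨by omega, by omega, ?_⟩
    constructor
    all_goals simp [State.setReg_reg, State.setReg_mem, hs0, hs]
    omega
  refine (h1.seq fun s' h' => Triple.loop (ScanInv n M s.mem a b) n h'
    (fun i t hi ht => ⟨?_, scanBody_spec hm ha hb hB i t hi ht⟩) fun t ht => ?_).mono ?_ fun _ h => h
  · rwa [ht.r8, ht.r0]
  · simp [ht.r8, ht.r0]
  · have : len scanBody ≤ 39 := by decide
    nlinarith

end Makespan

namespace Makespan

open Finset RAM RAM.Program RAM.Op

/-! ### The program: the reference assignment -/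

def greedyMove : Program :=
  block [arith add 5 5 12, arith sub 4 4 13, arith add 11 14 8, store 11 1]

/-- Move job `reg 8` to machine `0` if its ratio is `reg 9` and the load of machine `0`, in register
`5`, is less than the load of machine `1`, in register `4`. -/
def greedyBody : Program :=
  loadJob [arith mul 17 12 15, arith div 17 17 13,
    ite 17 9 skip (ite 9 17 skip (ite 5 4 greedyMove skip)), arith add 8 8 1]

/-- One pass over all jobs per ratio value replaces sorting; the `P ^ 3` passes stay within the time
bound. -/
def greedyRow : Program := seq (seq (const 8 0) (loop 8 0 greedyBody)) (arith add 9 9 1)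

def greedyStart : Program :=
  block [arith add 14 0 0, arith mul 15 2 2, arith mul 16 15 2, arith mul 6 15 15, const 9 1,
    arith add 16 16 1]

def greedy : Program := seq greedyStart (loop 9 16 greedyRow)

/-- The cells from `n + n` on mark the jobs moved to machine 0. Jobs with `a j = 0` lie in `G`
without a mark, so only the product of mark and time is tracked; it is the contribution `c j` to the
reference load. -/
structure GreedyInv (n P t : ℕ) (a b : ℕ → ℕ) (r i : ℕ) (s : State) : Prop where
  r0 : s.reg 0 = n
  r1 : s.reg 1 = 1
  r3 : s.reg 3 = t
  r6 : s.reg 6 = P ^ 4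
  r9 : s.reg 9 = r
  r10 : s.reg 10 = 0
  r14 : s.reg 14 = n + n
  r15 : s.reg 15 = P * P
  r16 : s.reg 16 = P * P * P + 1
  ref : ∃ G, Greedy n P a b r i G (s.reg 5) (s.reg 4) ∧
    ∀ j < n, s.mem (n + n + j) * a j = if j ∈ G then a j else 0
  input : Input n a b s.mem
  zero : ∀ y, n + n + n ≤ y → s.mem y = 0

variable {n P B t : ℕ} {a b : ℕ → ℕ}

theorem GreedyInv.skip {r i : ℕ} {s s' : State} (h : GreedyInv n P t a b r i s)
    (hm : s'.mem = s.mem)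
    (hr : ∀ x ∈ [0, 1, 3, 4, 5, 6, 9, 10, 14, 15, 16], s'.reg x = s.reg x)
    (hi : ratio P a b i = r → s.reg 4 ≤ s.reg 5) : GreedyInv n P t a b r (i + 1) s' := by
  simp only [List.forall_mem_cons] at hr
  obtain ⟨e0, e1, e3, e4, e5, e6, e9, e10, e14, e15, e16, -⟩ := hr
  obtain ⟨G, hG, hGm⟩ := h.ref
  constructor
  case ref => rw [e4, e5, hm]; exact ⟨G, hG.skip hi, hGm⟩
  case input => rw [hm]; exact h.input
  case zero => rw [hm]; exact h.zero
  all_goals simp only [e0, e1, e3, e6, e9, e10, e14, e15, e16, h.r0, h.r1, h.r3, h.r6, h.r9, h.r10,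
    h.r14, h.r15, h.r16]

theorem GreedyInv.move (ha : ∀ j, a j ≤ P) (hb : ∀ j, b j ≤ P) {r i : ℕ} {s s' : State}
    (h : GreedyInv n P t a b r i s) (hr0 : 0 < r) (hin : i < n)
    (hm : ∀ y, s'.mem y = if y = n + n + i then 1 else s.mem y)
    (hr : ∀ x ∈ [0, 1, 3, 6, 9, 10, 14, 15, 16], s'.reg x = s.reg x)
    (e4 : s'.reg 4 = s.reg 4 - b i) (e5 : s'.reg 5 = s.reg 5 + a i)
    (hi : ratio P a b i = r) (hlt : s.reg 5 < s.reg 4) : GreedyInv n P t a b r (i + 1) s' := by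
  simp only [List.forall_mem_cons] at hr
  obtain ⟨e0, e1, e3, e6, e9, e10, e14, e15, e16, -⟩ := hr
  obtain ⟨G, hG, hGm⟩ := h.ref
  constructor
  case ref =>
    rw [e4, e5]
    refine ⟨_, hG.move ha hb hr0 hin hi hlt, fun j hj => ?_⟩
    rw [hm]
    rcases eq_or_ne j i with rfl | hji
    · simp
    · rw [if_neg (by omega), hGm j hj]
      simp [hji]
  case input =>
    refine ⟨fun j hj => ?_, fun j hj => ?_⟩ <;> rw [hm, if_neg (by omega)]
    exacts [h.input.left j hj, h.input.right j hj]
  case zero =>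
    intro y hy
    rw [hm, if_neg (by omega)]
    exact h.zero y hy
  all_goals simp only [e0, e1, e3, e6, e9, e10, e14, e15, e16, h.r0, h.r1, h.r3, h.r6, h.r9, h.r10,
    h.r14, h.r15, h.r16]

theorem greedyBody_spec (ha : ∀ j, a j ≤ P) (hb : ∀ j, b j ≤ P)
    (hB : n * P + P + 3 * n + P * P * P + 1 ≤ B) {r : ℕ} (hr : 0 < r) (i : ℕ) (s : State)
    (hi : i < n) (h : GreedyInv n P t a b r i s ∧ s.reg 8 = i) :
    Triple B greedyBody (len greedyBody) s
      fun s' => GreedyInv n P t a b r (i + 1) s' ∧ s'.reg 8 = i + 1 := by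
  obtain ⟨h, h8⟩ := h
  obtain ⟨G, hG, hGm⟩ := h.ref
  have hai := ha i
  have hbi := hb i
  have hap : a i * (P * P) ≤ P * P * P := by
    rw [mul_assoc]
    exact Nat.mul_le_mul_right _ hai
  have hrat : a i * (P * P) / b i = ratio P a b i := rfl
  have hrP : ratio P a b i ≤ P * P * P := (Nat.div_le_self _ _).trans hap
  have hv : s.reg 4 ≤ n * P := by
    rw [hG.load_one]
    exact (sum_le_sum_of_subset sdiff_subset).trans (sum_range_le hb n)
  apply Triple.of_wp
  simp only [greedyBody, greedyMove, loadJob, block, wp, State.setReg_reg, State.setReg_mem,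
    State.setMem_reg, Op.eval, Nat.reduceEqDiff, if_true, if_false, h.r1, h8, h.r9, h.r15, h.r14,
    h.input.left i hi, h.input.right i hi, hrat, and_true]
  refine ⟨by omega, by omega, by omega, by omega, ?_⟩
  repeat' (first | apply And.intro | intro _)
  any_goals omega
  all_goals first
    | refine h.skip rfl ?_ (by omega)
      simp [State.setReg_reg]
    | refine h.move ha hb hr hi (fun y => ?_) ?_ ?_ ?_ (by omega) (by omega) <;>
      simp [State.setReg_reg, State.setReg_mem, State.setMem_mem, State.setMem_reg]

theorem greedyRow_spec (ha : ∀ j, a j ≤ P) (hb : ∀ j, b j ≤ P)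
    (hB : n * P + P + 3 * n + P * P * P + 2 ≤ B) (i : ℕ) (s : State)
    (hi : i < P * P * P) (h : GreedyInv n P t a b (i + 1) 0 s) :
    Triple B greedyRow (n * 40 + 40) s (GreedyInv n P t a b (i + 2) 0) := by
  have h1 : Triple B (const 8 0) 1 s
      fun s' => GreedyInv n P t a b (i + 1) 0 s' ∧ s'.reg 8 = 0 := by
    apply Triple.of_wp
    simp only [wp, State.setReg_reg, if_true, and_true]
    refine ⟨by omega, ?_⟩
    obtain ⟨G, hG⟩ := h.ref
    constructor
    case ref => exact ⟨G, by simpa [State.setReg_reg, State.setReg_mem] using hG⟩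
    case input => exact h.input
    case zero => exact h.zero
    all_goals simp [State.setReg_reg, h.r0, h.r1, h.r3, h.r6, h.r9, h.r10, h.r14, h.r15, h.r16]
  have h2 : ∀ s', (GreedyInv n P t a b (i + 1) n s' ∧ s'.reg 8 = n) →
      Triple B (arith add 9 9 1) 1 s' (GreedyInv n P t a b (i + 2) 0) := by
    rintro s' ⟨h, -⟩
    apply Triple.of_wp
    simp only [wp, Op.eval, h.r9, h.r1]
    refine ⟨by omega, ?_⟩
    obtain ⟨G, hG, hGm⟩ := h.ref
    constructor
    case ref => exact ⟨G, by simpa [State.setReg_reg] using hG.next_ratio, hGm⟩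
    case input => exact h.input
    case zero => exact h.zero
    all_goals simp [State.setReg_reg, h.r0, h.r1, h.r3, h.r6, h.r10, h.r14, h.r15, h.r16]
  refine ((h1.seq fun s' h' => Triple.loop
    (fun j s => GreedyInv n P t a b (i + 1) j s ∧ s.reg 8 = j) n h'
    (fun j t hj ht => ⟨?_, greedyBody_spec ha hb (by omega) (by omega) j t hj ht⟩)
    fun t ht => ?_).seq h2).mono ?_ fun _ h => h
  · rwa [ht.2, ht.1.r0]
  · simp [ht.2, ht.1.r0]
  · have : len greedyBody ≤ 37 := by decide
    nlinarith

/-- The constant registers after the reference has been found: `g` is its load on machine `0`, and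
`Q` bounds the deviation. -/
structure Setup (n Q t g : ℕ) (s : State) : Prop where
  r0 : s.reg 0 = n
  r1 : s.reg 1 = 1
  r3 : s.reg 3 = t
  r5 : s.reg 5 = g
  r6 : s.reg 6 = Q
  r10 : s.reg 10 = 0
  r14 : s.reg 14 = n + n

theorem greedy_spec {M : ℕ} {s : State} (ha : ∀ j, j < n ∨ a j = 0) (hb : ∀ j, j < n ∨ b j = 0)
    (h : ScanInv n M s.mem a b n s) (hm : Input n a b s.mem) (hz : ∀ y, n + n ≤ y → s.mem y = 0)
    (hB : n * M + M + 3 * n + M ^ 4 + 2 ≤ B) :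
    Triple B greedy (M ^ 3 * (n * 40 + 41) + 9) s fun s' => ∃ P G, 0 < P ∧ P ≤ M ∧
      (∀ j, a j ≤ P) ∧ (∀ j, b j ≤ P) ∧ Reference n P a b G ∧ Input n a b s'.mem ∧
      (∀ j < n, s'.mem (n + n + j) * a j = if j ∈ G then a j else 0) ∧
      (∀ y, n + n + n ≤ y → s'.mem y = 0) ∧
      Setup n (P ^ 4) (∑ j ∈ range n, b j) (∑ j ∈ G, a j) s' := by
  obtain ⟨P, hP⟩ : ∃ P, P = s.reg 2 := ⟨_, rfl⟩
  have hP0 := h.pos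
  have hPM := h.le
  have hmax := h.max
  rw [← hP] at hP0 hPM hmax
  have haP : ∀ j, a j ≤ P := fun j => (ha j).elim (fun h => (hmax j h).1) fun h => by omega
  have hbP : ∀ j, b j ≤ P := fun j => (hb j).elim (fun h => (hmax j h).2) fun h => by omega
  have p4 : P * P * (P * P) ≤ M ^ 4 := by
    calc P * P * (P * P) = P ^ 4 := by ring
      _ ≤ M ^ 4 := Nat.pow_le_pow_left hPM 4
  have p3 : P * P * P ≤ P * P * (P * P) := Nat.mul_le_mul_left _ (Nat.le_mul_of_pos_left _ hP0)
  have p2 : P * P ≤ P * P * P := Nat.le_mul_of_pos_right _ hP0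
  have p1 : n * P ≤ n * M := Nat.mul_le_mul_left _ hPM
  have h1 : Triple B greedyStart (len greedyStart) s
      (GreedyInv n P (∑ j ∈ range n, b j) a b 1 0) := by
    apply Triple.of_wp
    simp only [greedyStart, block, wp, State.setReg_reg, Op.eval, Nat.reduceEqDiff, if_true,
      if_false, h.r0, h.r1, ← hP]
    refine ⟨by omega, by omega, by omega, by omega, by omega, by omega, ?_⟩
    constructor
    case ref =>
      refine ⟨{j ∈ range n | a j = 0}, ?_, ?_⟩
      · simp only [State.setReg_reg, Nat.reduceEqDiff, if_false, h.r4, h.r5]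
        exact Greedy.init hbP
      · intro j hj
        rw [State.setReg_mem, State.setReg_mem, State.setReg_mem, State.setReg_mem,
          State.setReg_mem, State.setReg_mem, hz _ (by omega)]
        simp only [mem_filter]
        split <;> omega
    case input => exact hm
    case zero => exact fun y hy => hz y (by omega)
    case r6 =>
      simp only [State.setReg_reg, Nat.reduceEqDiff, if_true, if_false]
      ring
    all_goals simp [State.setReg_reg, h.r0, h.r1, h.r3, h.r10]
  refine (h1.seq fun s' h' => Triple.loop
    (fun i => GreedyInv n P (∑ j ∈ range n, b j) a b (i + 1) 0) (P * P * P) h'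
    (fun i t hi ht => ⟨?_, greedyRow_spec haP hbP (by omega) i t hi ht⟩)
    fun t ht => ?_).mono ?_ fun t ht => ?_
  · rw [ht.r9, ht.r16]
    omega
  · rw [ht.r9, ht.r16]
    omega
  · have : len greedyStart ≤ 8 := by decide
    have : P * P * P ≤ M ^ 3 := by
      calc P * P * P = P ^ 3 := by ring
        _ ≤ M ^ 3 := Nat.pow_le_pow_left hPM 3
    nlinarith [Nat.mul_le_mul_right (n * 40 + 40 + 1) this]
  · obtain ⟨G, hG, hGm⟩ := ht.ref
    exact ⟨P, G, hP0, hPM, haP, hbP, hG.reference haP hbP, ht.input, hGm, ht.zero,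
      ht.r0, ht.r1, ht.r3, hG.load_zero, ht.r6, ht.r10, ht.r14⟩

end Makespan

namespace Makespan

open Finset RAM RAM.Program RAM.Op

/-! ### The program: the table of the dynamic program -/

/-- Behind the `2 * n` input cells and `n` marks lie `n + 1` rows of width `9 * Q`: indices in the
window from `Q` to `8 * Q` may look up entries up to `Q` further on either side. Row `n` belongs to
no jobs and gets its single 1 at `4 * Q`. -/
def tableStart : Program :=
  block [const 7 9, arith mul 7 7 6, const 18 4, arith mul 18 18 6, arith add 19 18 18,
    arith add 20 14 0, arith mul 21 0 7, arith add 21 21 20, arith add 11 21 18, store 11 1,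
    const 9 0]

/-- Compute entry `reg 8` of the row at `reg 23` from the row at `reg 21`. -/
def entryBody : Program :=
  block [arith add 11 8 17, arith add 11 11 21, Program.load 24 11, arith sub 11 11 12,
    Program.load 25 11,
    ite 10 25 (seq (arith add 25 25 13) (ite 24 25 (arith add 24 25 10) skip)) skip,
    arith add 11 23 8, store 11 24, arith add 8 8 1]

def rowStart : Program :=
  seq (seq (arith add 9 9 1) (arith sub 8 0 9))
    (loadJob [arith add 11 14 8, Program.load 17 11, arith mul 17 17 12, arith sub 23 21 7,
      arith add 8 6 10])

def rowBody : Program := seq (seq rowStart (loop 8 19 entryBody)) (arith add 21 23 10)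

def fillTable : Program := seq tableStart (loop 9 0 rowBody)

structure TableRegs (n Q t g : ℕ) (s : State) : Prop extends Setup n Q t g s where
  r7 : s.reg 7 = 9 * Q
  r18 : s.reg 18 = 4 * Q
  r19 : s.reg 19 = 8 * Q

theorem TableRegs.congr {n Q t g : ℕ} {s s' : State} (h : TableRegs n Q t g s)
    (hr : ∀ x ∈ [0, 1, 3, 5, 6, 10, 14, 7, 18, 19], s'.reg x = s.reg x) :
    TableRegs n Q t g s' := by
  simp only [List.forall_mem_cons] at hr
  obtain ⟨e0, e1, e3, e5, e6, e10, e14, e7, e18, e19, -⟩ := hr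
  exact ⟨⟨e0.trans h.r0, e1.trans h.r1, e3.trans h.r3, e5.trans h.r5, e6.trans h.r6,
    e10.trans h.r10, e14.trans h.r14⟩, e7.trans h.r7, e18.trans h.r18, e19.trans h.r19⟩

/-- A new entry of the table, computed from the previous row `T`. -/
def entry (T : ℕ → ℕ) (α β γ x : ℕ) : ℕ :=
  if 0 < T (x + γ - α) then max (T (x + γ)) (T (x + γ - α) + β) else T (x + γ)

structure EntryInv (n Q t g k α β γ u v : ℕ) (m T : ℕ → ℕ) (i : ℕ) (s : State) : Prop
    extends TableRegs n Q t g s where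
  r8 : s.reg 8 = Q + i
  r9 : s.reg 9 = k
  r12 : s.reg 12 = α
  r13 : s.reg 13 = β
  r17 : s.reg 17 = γ
  r21 : s.reg 21 = u
  r23 : s.reg 23 = v
  frame : ∀ y, y < v + Q ∨ v + Q + i ≤ y → s.mem y = m y
  row : ∀ x, Q ≤ x → x < Q + i → s.mem (v + x) = entry T α β γ x

variable {n Q B t g : ℕ}

theorem entryBody_spec {k α β γ u v : ℕ} {m T : ℕ → ℕ} (hα : α ≤ Q) (hγ : γ ≤ Q)
    (huv : u = v + 9 * Q) (hT : ∀ x < 9 * Q, m (u + x) = T x ∧ T x + β ≤ B)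
    (hB : u + 9 * Q + 1 ≤ B) (i : ℕ) (s : State) (hi : i < 7 * Q)
    (h : EntryInv n Q t g k α β γ u v m T i s) :
    Triple B entryBody (len entryBody) s (EntryInv n Q t g k α β γ u v m T (i + 1)) := by
  have m1 : s.mem (Q + i + γ + u) = T (Q + i + γ) := by
    rw [h.frame _ (by omega), ← (hT _ (by omega)).1, add_comm]
  have m2 : s.mem (Q + i + γ + u - α) = T (Q + i + γ - α) := by
    rw [h.frame _ (by omega), ← (hT _ (by omega)).1]
    congr 1
    omega
  have b2 := (hT (Q + i + γ - α) (by omega)).2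
  have hnext : ∀ s', (∀ x ∈ [0, 1, 3, 5, 6, 10, 14, 7, 18, 19, 9, 12, 13, 17, 21, 23],
      s'.reg x = s.reg x) → s'.reg 8 = Q + i + 1 →
      (∀ y, s'.mem y = if y = v + (Q + i) then entry T α β γ (Q + i) else s.mem y) →
      EntryInv n Q t g k α β γ u v m T (i + 1) s' := by
    intro s' hr h8 hm
    refine ⟨h.toTableRegs.congr fun x hx => hr x ?_, h8, (hr 9 (by simp)).trans h.r9,
      (hr 12 (by simp)).trans h.r12, (hr 13 (by simp)).trans h.r13, (hr 17 (by simp)).trans h.r17,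
      (hr 21 (by simp)).trans h.r21, (hr 23 (by simp)).trans h.r23, fun y hy => ?_,
      fun x hx hx' => ?_⟩
    · simp only [List.mem_cons] at hx ⊢
      tauto
    · rw [hm, if_neg (by omega), h.frame y (by omega)]
    · rcases eq_or_ne x (Q + i) with rfl | hne
      · rw [hm, if_pos rfl]
      · rw [hm, if_neg (by omega), h.row x hx (by omega)]
  apply Triple.of_wp
  simp only [entryBody, block, wp, State.setReg_reg, State.setReg_mem, State.setMem_reg, Op.eval,
    Nat.reduceEqDiff, if_true, if_false, h.r1, h.r8, h.r10, h.r12, h.r13, h.r17, h.r21, h.r23,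
    m1, m2]
  refine ⟨by omega, by omega, by omega, ?_⟩
  repeat' (first | apply And.intro | intro _)
  any_goals omega
  all_goals
    refine hnext _ ?_ ?_ fun y => ?_
    · simp [State.setReg_reg, State.setMem_reg]
    · simp [State.setReg_reg]
    · simp only [State.setReg_mem, State.setMem_mem, entry]
      congr 1
      split <;> omega

/-- The rows for the jobs from `n - k` on are complete, and the cells below are still empty. -/
structure TableInv (n Q t g : ℕ) (a b c m : ℕ → ℕ) (k : ℕ) (s : State) : Prop
    extends TableRegs n Q t g s where
  r9 : s.reg 9 = k
  r21 : s.reg 21 = n + n + n + (n - k) * (9 * Q)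
  low : ∀ y < n + n + n, s.mem y = m y
  rows : ∀ j ≤ n, n - k ≤ j → ∀ x < 9 * Q,
    s.mem (n + n + n + j * (9 * Q) + x) = table n Q a b c (n - j) x
  zero : ∀ y, n + n + n ≤ y → y < n + n + n + (n - k) * (9 * Q) → s.mem y = 0

variable {a b c m : ℕ → ℕ}

theorem rowBody_spec (hm : Input n a b m) (hc : ∀ j < n, m (n + n + j) * a j = c j)
    (ha : ∀ j, a j ≤ Q) (hcQ : ∀ j, c j ≤ Q) (hb : ∀ j, b j ≤ Q)
    (hB : 3 * n + n * (9 * Q) + 9 * Q + n * Q + 2 ≤ B)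
    (k : ℕ) (s : State) (hk : k < n) (h : TableInv n Q t g a b c m k s) :
    Triple B rowBody (Q * 140 + 30) s (TableInv n Q t g a b c m (k + 1)) := by
  obtain ⟨j, hj⟩ : ∃ j, j = n - (k + 1) := ⟨_, rfl⟩
  -- Naming the product keeps the address arithmetic linear for `omega`.
  obtain ⟨w, hw⟩ : ∃ w, w = j * (9 * Q) := ⟨_, rfl⟩
  have hjn : j < n := by omega
  have hnk : n - k = j + 1 := by omega
  have hrow : (n - k) * (9 * Q) = w + 9 * Q := by rw [hnk, hw]; ring
  have hwn : w + 9 * Q ≤ n * (9 * Q) := by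
    rw [← hrow]
    exact Nat.mul_le_mul_right _ (by omega)
  have hkQ : k * Q + Q ≤ n * Q := by
    calc k * Q + Q = (k + 1) * Q := by ring
      _ ≤ n * Q := Nat.mul_le_mul_right _ hk
  have haj := ha j
  have hcj := hcQ j
  have h1 : Triple B rowStart (len rowStart) s (EntryInv n Q t g (k + 1) (a j) (b j) (c j)
      (n + n + n + w + 9 * Q) (n + n + n + w) s.mem (table n Q a b c k) 0) := by
    have ml : s.mem (j + j) = a j := by rw [h.low _ (by omega), hm.left j hjn]
    have mr : s.mem (j + j + 1) = b j := by rw [h.low _ (by omega), hm.right j hjn]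
    have mc : s.mem (n + n + j) * a j = c j := by rw [h.low _ (by omega), hc j hjn]
    apply Triple.of_wp
    simp only [rowStart, loadJob, block, wp, State.setReg_reg, State.setReg_mem, Op.eval,
      Nat.reduceEqDiff, if_true, if_false, h.r0, h.r1, h.r6, h.r7, h.r9, h.r10, h.r14, h.r21, ← hj,
      ml, mr, mc, hrow]
    refine ⟨by omega, by omega, by omega, by omega, by omega, by omega, by omega, by omega, ?_⟩
    refine ⟨h.toTableRegs.congr ?_, ?_, ?_, ?_, ?_, ?_, ?_, ?_, fun _ _ => rfl, fun x _ _ => ?_⟩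
    all_goals first | omega | simp [State.setReg_reg, h.r21, hrow]
    all_goals omega
  have hT : ∀ x < 9 * Q, s.mem (n + n + n + w + 9 * Q + x) = table n Q a b c k x ∧
      table n Q a b c k x + b j ≤ B := by
    intro x hx
    have e := h.rows (n - k) (by omega) le_rfl x hx
    rw [hrow, show n - (n - k) = k by omega] at e
    have := table_le (n := n) (Q := Q) (a := a) (c := c) hb k x
    have := hb j
    exact ⟨by rw [← e]; congr 1; omega, by omega⟩
  have h2 : ∀ s', EntryInv n Q t g (k + 1) (a j) (b j) (c j) (n + n + n + w + 9 * Q)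
      (n + n + n + w) s.mem (table n Q a b c k) (7 * Q) s' →
      Triple B (arith add 21 23 10) 1 s' (TableInv n Q t g a b c m (k + 1)) := by
    intro s' h'
    apply Triple.of_wp
    simp only [wp, Op.eval, h'.r23, h'.r10]
    refine ⟨by omega, h'.toTableRegs.congr (by simp [State.setReg_reg]), ?_, ?_, ?_, ?_, ?_⟩
    · simp [State.setReg_reg, h'.r9]
    · simp [State.setReg_reg, ← hj, hw]
    · intro y hy
      rw [State.setReg_mem, h'.frame y (by omega), h.low y hy]
    · intro i hi hji x hx
      rw [State.setReg_mem]
      rcases eq_or_ne i j with rfl | hne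
      · rw [← hw, show n - i = k + 1 by omega, table, ← hj]
        -- Outside the window nothing is written: the empty cell already holds the 0 that stands for
        -- infeasibility.
        by_cases hx' : Q ≤ x ∧ x < 8 * Q
        · rw [if_pos hx', h'.row x hx'.1 (by omega), entry]
        · rw [if_neg hx', h'.frame _ (by omega), h.zero _ (by omega) (by omega)]
      · have hi' : w + 9 * Q ≤ i * (9 * Q) := by
          rw [← hrow]
          exact Nat.mul_le_mul_right _ (by omega)
        rw [h'.frame _ (by omega), h.rows i hi (by omega) x hx]
    · intro y hy hy'
      rw [← hj, ← hw] at hy'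
      rw [State.setReg_mem, h'.frame y (by omega), h.zero y hy (by omega)]
  refine ((h1.seq fun s' h' => Triple.loop (EntryInv n Q t g (k + 1) (a j) (b j) (c j)
    (n + n + n + w + 9 * Q) (n + n + n + w) s.mem (table n Q a b c k)) (7 * Q) h'
    (fun i t hi ht => ⟨?_, entryBody_spec haj hcj rfl hT (by omega) i t hi ht⟩)
    fun t ht => ?_).seq h2).mono ?_ fun _ h => h
  · rw [ht.r8, ht.r19]
    omega
  · rw [ht.r8, ht.r19]
    omega
  · have : len entryBody ≤ 18 := by decide
    have : len rowStart ≤ 20 := by decide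
    nlinarith

theorem fillTable_spec {s : State} (hQ : 0 < Q) (hs : Setup n Q t g s) (hm : Input n a b s.mem)
    (hc : ∀ j < n, s.mem (n + n + j) * a j = c j) (hz : ∀ y, n + n + n ≤ y → s.mem y = 0)
    (ha : ∀ j, a j ≤ Q) (hcQ : ∀ j, c j ≤ Q) (hb : ∀ j, b j ≤ Q)
    (hB : 3 * n + n * (9 * Q) + 9 * Q + n * Q + 20 ≤ B) :
    Triple B fillTable (n * (Q * 140 + 31) + 20) s (TableInv n Q t g a b c s.mem n) := by
  have h1 : Triple B tableStart (len tableStart) s (TableInv n Q t g a b c s.mem 0) := by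
    apply Triple.of_wp
    simp only [tableStart, block, wp, State.setReg_reg, Op.eval,
      Nat.reduceEqDiff, if_true, if_false, hs.r0, hs.r1, hs.r6, hs.r14]
    refine ⟨by omega, by omega, by omega, by omega, by omega, by omega, by omega, by omega,
      by omega, by omega, ?_⟩
    constructor
    case toTableRegs =>
      refine ⟨⟨?_, ?_, ?_, ?_, ?_, ?_, ?_⟩, ?_, ?_, ?_⟩
      all_goals simp [State.setReg_reg, State.setMem_reg, hs.r0, hs.r1, hs.r3, hs.r5, hs.r6, hs.r10,
        hs.r14]
      omega
    case r9 => simp [State.setReg_reg]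
    case r21 => simp [State.setReg_reg, State.setMem_reg, add_comm]
    case low =>
      intro y hy
      simp only [State.setReg_mem, State.setMem_mem]
      rw [if_neg (by omega)]
    case rows =>
      intro j hj hj' x hx
      obtain rfl : j = n := by omega
      simp only [State.setReg_mem, State.setMem_mem, Nat.sub_self, table]
      rw [hz _ (by omega)]
      split <;> split <;> omega
    case zero =>
      intro y hy hy'
      rw [Nat.sub_zero] at hy'
      simp only [State.setReg_mem, State.setMem_mem]
      rw [if_neg (by omega), hz y hy]
  refine (h1.seq fun s' h' => Triple.loop (TableInv n Q t g a b c s.mem) n h'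
    (fun k t hk ht => ⟨?_, rowBody_spec hm hc ha hcQ hb (by omega) k t hk ht⟩)
    fun t ht => ?_).mono ?_ fun _ h => h
  · rwa [ht.r9, ht.r0]
  · simp [ht.r9, ht.r0]
  · have : len tableStart ≤ 15 := by decide
    nlinarith

end Makespan

namespace Makespan

open Finset RAM RAM.Program RAM.Op

/-! ### The program: selection of the best entry and reconstruction -/

def selectStart : Program :=
  block [arith add 28 3 1, arith add 26 28 10, const 27 0, arith add 8 6 10]

/-- Compare the makespan of entry `reg 8` of the row at `reg 21` with the least one so far, in
`reg 26`. -/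
def selectBody : Program :=
  block [arith add 11 21 8, Program.load 24 11,
    ite 10 24 (block [arith add 12 5 8, arith sub 12 12 18, arith sub 13 28 24,
      ite 12 13 (arith add 12 13 10) skip,
      ite 12 26 (seq (arith add 26 12 10) (arith add 27 8 10)) skip]) skip,
    arith add 8 8 1]

def select : Program := seq selectStart (loop 8 19 selectBody)

def traceEnd : Program :=
  block [arith add 11 21 27, Program.load 24 11, arith add 21 21 7, arith add 27 27 17,
    arith sub 23 27 12, arith add 11 21 23, Program.load 25 11, const 29 1,
    ite 10 25 (seq (arith add 25 25 13)
      (ite 25 24 skip (seq (arith add 27 23 10) (const 29 0)))) skip,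
    store 8 29, arith add 8 8 1]

/-- Find the machine of job `reg 8` from entry `reg 27` of the row at `reg 21`. -/
def traceBody : Program :=
  loadJob [arith add 11 14 8, Program.load 17 11, arith mul 17 17 12, traceEnd]

def traceBack : Program := seq (seq (const 8 0) (loop 8 0 traceBody)) (arith add 0 26 10)

structure SelectInv (n Q t g u : ℕ) (m T : ℕ → ℕ) (i : ℕ) (s : State) : Prop
    extends TableRegs n Q t g s where
  mem : s.mem = m
  r8 : s.reg 8 = Q + i
  r21 : s.reg 21 = u
  r28 : s.reg 28 = t + 1
  low : ∀ z, Q ≤ z → z < Q + i → 0 < T z → s.reg 26 ≤ max (g + z - 4 * Q) (t + 1 - T z)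
  best : s.reg 26 = t + 1 ∨
    0 < T (s.reg 27) ∧ s.reg 26 = max (g + s.reg 27 - 4 * Q) (t + 1 - T (s.reg 27))

variable {n Q B t g : ℕ}

theorem selectBody_spec {u : ℕ} {m T : ℕ → ℕ} (hT : ∀ x < 9 * Q, m (u + x) = T x)
    (hB : u + g + t + 9 * Q + 1 ≤ B) (i : ℕ) (s : State) (hi : i < 7 * Q)
    (h : SelectInv n Q t g u m T i s) :
    Triple B selectBody (len selectBody) s (SelectInv n Q t g u m T (i + 1)) := by
  have hm := hT (Q + i) (by omega)
  have hlow := h.low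
  have hbest := h.best
  have hnext : ∀ s', (∀ x ∈ [0, 1, 3, 5, 6, 10, 14, 7, 18, 19, 21, 28], s'.reg x = s.reg x) →
      s'.mem = s.mem → s'.reg 8 = Q + i + 1 →
      (0 < T (Q + i) → s'.reg 26 ≤ max (g + (Q + i) - 4 * Q) (t + 1 - T (Q + i))) →
      (s'.reg 26 = s.reg 26 ∧ s'.reg 27 = s.reg 27 ∨ s'.reg 26 < s.reg 26 ∧ s'.reg 27 = Q + i ∧
        0 < T (Q + i) ∧ s'.reg 26 = max (g + (Q + i) - 4 * Q) (t + 1 - T (Q + i))) →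
      SelectInv n Q t g u m T (i + 1) s' := by
    intro s' hr hm h8 hle hbest
    refine ⟨h.toTableRegs.congr fun x hx => hr x ?_, hm.trans h.mem, h8,
      (hr 21 (by simp)).trans h.r21, (hr 28 (by simp)).trans h.r28, fun z hz hz' hTz => ?_, ?_⟩
    · simp only [List.mem_cons] at hx ⊢
      tauto
    · rcases eq_or_ne z (Q + i) with rfl | hne
      · exact hle hTz
      · have := h.low z hz (by omega) hTz
        omega
    · rcases hbest with ⟨h1, h2⟩ | ⟨h1, h2, h3, h4⟩
      · rw [h1, h2]
        exact h.best
      · rw [h2]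
        exact Or.inr ⟨h3, h4⟩
  apply Triple.of_wp
  simp only [selectBody, block, wp, State.setReg_reg, State.setReg_mem, Op.eval,
    Nat.reduceEqDiff, if_true, if_false, h.r1, h.r5, h.r8, h.r10, h.r18, h.r21, h.r28, h.mem, hm]
  refine ⟨by omega, ?_⟩
  repeat' (first | apply And.intro | intro _)
  any_goals omega
  all_goals
    refine hnext _ ?_ ?_ ?_ ?_ ?_
    · simp [State.setReg_reg]
    · simp [State.setReg_mem]
    · simp [State.setReg_reg]
    · simp only [State.setReg_reg, Nat.reduceEqDiff, if_true, if_false]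
      intro _
      omega
    · simp only [State.setReg_reg, Nat.reduceEqDiff, if_true, if_false, true_and, true_or]
      try exact Or.inr ⟨by omega, by omega, by omega, by omega⟩

theorem select_spec {u : ℕ} {T : ℕ → ℕ} {s : State} (hs : TableRegs n Q t g s) (hu : s.reg 21 = u)
    (hT : ∀ x < 9 * Q, s.mem (u + x) = T x) (hB : u + g + t + 9 * Q + 1 ≤ B) :
    Triple B select (Q * 280 + 20) s (SelectInv n Q t g u s.mem T (7 * Q)) := by
  have h1 : Triple B selectStart (len selectStart) s (SelectInv n Q t g u s.mem T 0) := by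
    apply Triple.of_wp
    simp only [selectStart, block, wp, State.setReg_reg, Op.eval, Nat.reduceEqDiff, if_true,
      if_false, hs.r1, hs.r3, hs.r6, hs.r10]
    refine ⟨by omega, by omega, by omega, by omega, ?_⟩
    refine ⟨hs.congr (by simp [State.setReg_reg]), rfl, ?_, ?_, ?_, fun z _ _ => ?_, Or.inl ?_⟩
    all_goals first | omega | simp [State.setReg_reg, hu]
  refine (h1.seq fun s' h' => Triple.loop (SelectInv n Q t g u s.mem T) (7 * Q) h'
    (fun i t hi ht => ⟨?_, selectBody_spec hT hB i t hi ht⟩)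
    fun t ht => ?_).mono ?_ fun _ h => h
  · rw [ht.r8, ht.r19]
    omega
  · rw [ht.r8, ht.r19]
    omega
  · have : len selectBody ≤ 30 := by decide
    have : len selectStart ≤ 10 := by decide
    nlinarith

/-- The answer overwrites the input. This is harmless, as only cells below `j` have changed while
job `j` and all later ones read cells from `j` on. -/
structure TraceInv (n Q t g : ℕ) (a b c m : ℕ → ℕ) (z w j : ℕ) (s : State) : Prop
    extends TableRegs n Q t g s where
  r8 : s.reg 8 = j
  r21 : s.reg 21 = n + n + n + j * (9 * Q)
  r26 : s.reg 26 = w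
  frame : ∀ y, j ≤ y → s.mem y = m y
  trace : ∃ S, Trace n Q a b c z j (s.reg 27) S ∧ ∀ i < j, s.mem i = if i ∈ S then 0 else 1

variable {a b c m : ℕ → ℕ}

theorem TraceInv.next {z w j x e : ℕ} {S : Finset ℕ} {s s' : State}
    (h : TraceInv n Q t g a b c m z w j s) (hS : Trace n Q a b c z j x S)
    (hSm : ∀ i < j, s.mem i = if i ∈ S then 0 else 1)
    (hr : ∀ x ∈ [0, 1, 3, 5, 6, 10, 14, 7, 18, 19, 26], s'.reg x = s.reg x)
    (h8 : s'.reg 8 = j + 1) (h21 : s'.reg 21 = n + n + n + j * (9 * Q) + 9 * Q)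
    (hm : ∀ y, s'.mem y = if y = j then e else s.mem y)
    (hS' : e = 0 ∧ Trace n Q a b c z (j + 1) (s'.reg 27) (insert j S) ∨
      e = 1 ∧ Trace n Q a b c z (j + 1) (s'.reg 27) S) :
    TraceInv n Q t g a b c m z w (j + 1) s' := by
  refine ⟨h.toTableRegs.congr fun x hx => hr x ?_, h8, ?_, (hr 26 (by simp)).trans h.r26,
    fun y hy => ?_, ?_⟩
  · simp only [List.mem_cons] at hx ⊢
    tauto
  · rw [h21]
    ring
  · rw [hm, if_neg (by omega), h.frame y (by omega)]
  · have hjS : j ∉ S := fun hjS => by simpa using hS.sub hjS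
    rcases hS' with ⟨rfl, hS'⟩ | ⟨rfl, hS'⟩
    all_goals
      refine ⟨_, hS', fun i hi => ?_⟩
      rw [hm]
      rcases eq_or_ne i j with rfl | hne
      · simp [hjS]
      · simp [hne, hSm i (by omega)]

set_option maxHeartbeats 1000000 in
theorem traceBody_spec {z w : ℕ} (hm : Input n a b m) (hc : ∀ j < n, m (n + n + j) * a j = c j)
    (hT : ∀ j ≤ n, ∀ x < 9 * Q, m (n + n + n + j * (9 * Q) + x) = table n Q a b c (n - j) x)
    (ha : ∀ j, a j ≤ Q) (hcQ : ∀ j, c j ≤ Q) (hb : ∀ j, b j ≤ Q)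
    (hB : 3 * n + n * (9 * Q) + 9 * Q + n * Q + 2 ≤ B)
    (j : ℕ) (s : State) (hj : j < n) (h : TraceInv n Q t g a b c m z w j s) :
    Triple B traceBody (len traceBody) s (TraceInv n Q t g a b c m z w (j + 1)) := by
  obtain ⟨S, hS, hSm⟩ := h.trace
  obtain ⟨x, hx⟩ : ∃ x, x = s.reg 27 := ⟨_, rfl⟩
  obtain ⟨v, hv⟩ : ∃ v, v = j * (9 * Q) := ⟨_, rfl⟩
  rw [← hx] at hS
  obtain ⟨⟨hxQ, hxQ'⟩, -⟩ := hS.table_eq hj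
  have haj := ha j
  have hcj := hcQ j
  have hbj := hb j
  have hrow : (j + 1) * (9 * Q) = v + 9 * Q := by rw [hv]; ring
  have hvn : v + 9 * Q ≤ n * (9 * Q) := by
    rw [← hrow]
    exact Nat.mul_le_mul_right _ (by omega)
  have ml : s.mem (j + j) = a j := by rw [h.frame _ (by omega), hm.left j hj]
  have mr : s.mem (j + j + 1) = b j := by rw [h.frame _ (by omega), hm.right j hj]
  have mc : s.mem (n + n + j) * a j = c j := by rw [h.frame _ (by omega), hc j hj]
  have mv : s.mem (n + n + n + v + x) = table n Q a b c (n - j) x := by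
    rw [h.frame _ (by omega), hv, hT j (by omega) x (by omega)]
  have m1 : s.mem (n + n + n + v + 9 * Q + (x + c j - a j))
      = table n Q a b c (n - (j + 1)) (x + c j - a j) := by
    rw [h.frame _ (by omega), ← hT (j + 1) hj _ (by omega), hrow]
    congr 1
    omega
  have hle := table_le (n := n) (Q := Q) (a := a) (c := c) hb (n - (j + 1)) (x + c j - a j)
  have hkQ : (n - (j + 1)) * Q + Q ≤ n * Q := by
    calc (n - (j + 1)) * Q + Q = (n - (j + 1) + 1) * Q := by ring
      _ ≤ n * Q := Nat.mul_le_mul_right _ (by omega)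
  apply Triple.of_wp
  simp only [traceBody, traceEnd, loadJob, block, wp, State.setReg_reg, State.setReg_mem,
    State.setMem_reg, Op.eval, Nat.reduceEqDiff, if_true, if_false, h.r1, h.r7, h.r8, h.r10, h.r14, h.r21, ← hx, ← hv,
    ml, mr, mc, mv, m1]
  refine ⟨by omega, by omega, by omega, by omega, by omega, by omega, by omega, by omega, by omega,
    by omega, ?_⟩
  repeat' (first | apply And.intro | intro _)
  any_goals omega
  all_goals
    first
    | refine h.next (e := 0) hS hSm ?_ ?_ ?_ (fun y => ?_) (Or.inl ⟨rfl, ?_⟩)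
      rotate_left 4
      · simpa [State.setReg_reg, State.setMem_reg] using hS.take hj haj (by omega) (by omega)
      all_goals simp [State.setReg_reg, State.setReg_mem, State.setMem_reg, State.setMem_mem, hv]
    | refine h.next (e := 1) hS hSm ?_ ?_ ?_ (fun y => ?_) (Or.inr ⟨rfl, ?_⟩)
      rotate_left 4
      · simpa [State.setReg_reg, State.setMem_reg] using hS.leave hj (by omega)
      all_goals simp [State.setReg_reg, State.setReg_mem, State.setMem_reg, State.setMem_mem, hv]

theorem traceBack_spec {z w : ℕ} {s : State} (hs : TableRegs n Q t g s) (hm : Input n a b s.mem)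
    (hc : ∀ j < n, s.mem (n + n + j) * a j = c j)
    (hT : ∀ j ≤ n, ∀ x < 9 * Q, s.mem (n + n + n + j * (9 * Q) + x) = table n Q a b c (n - j) x)
    (ha : ∀ j, a j ≤ Q) (hcQ : ∀ j, c j ≤ Q) (hb : ∀ j, b j ≤ Q)
    (hB : 3 * n + n * (9 * Q) + 9 * Q + n * Q + 2 ≤ B) (h21 : s.reg 21 = n + n + n)
    (h26 : s.reg 26 = w) (h27 : s.reg 27 = z) (hz : 0 < table n Q a b c n z) (hw : w ≤ B) :
    Triple B traceBack (n * 50 + 10) s fun s' => s'.reg 0 = w ∧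
      ∃ x S, Trace n Q a b c z n x S ∧ ∀ i < n, s'.mem i = if i ∈ S then 0 else 1 := by
  have h1 : Triple B (const 8 0) 1 s (TraceInv n Q t g a b c s.mem z w 0) := by
    apply Triple.of_wp
    refine ⟨by omega, hs.congr (by simp [State.setReg_reg]), ?_, ?_, ?_, fun y _ => rfl, ∅, ?_, ?_⟩
    · simp [State.setReg_reg]
    · simp [State.setReg_reg, h21]
    · simp [State.setReg_reg, h26]
    · simpa [State.setReg_reg, h27] using Trace.init hz
    · simp
  have h2 : ∀ s', TraceInv n Q t g a b c s.mem z w n s' → Triple B (arith add 0 26 10) 1 s'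
      fun s' => s'.reg 0 = w ∧
        ∃ x S, Trace n Q a b c z n x S ∧ ∀ i < n, s'.mem i = if i ∈ S then 0 else 1 := by
    intro s' h'
    obtain ⟨S, hS, hSm⟩ := h'.trace
    apply Triple.of_wp
    simp only [wp, Op.eval, h'.r26, h'.r10, State.setReg_reg, if_true]
    exact ⟨by omega, by omega, _, S, hS, hSm⟩
  refine ((h1.seq fun s' h' => Triple.loop (TraceInv n Q t g a b c s.mem z w) n h'
    (fun j t hj ht => ⟨?_, traceBody_spec hm hc hT ha hcQ hb hB j t hj ht⟩)
    fun t ht => ?_).seq h2).mono ?_ fun _ h => h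
  · rwa [ht.r8, ht.r0]
  · simp [ht.r8, ht.r0]
  · have : len traceBody ≤ 49 := by decide
    nlinarith

end Makespan

namespace Makespan

open Finset RAM RAM.Program RAM.Op

/-! ### The whole program -/

theorem cost_eq_makespan {n : ℕ} (p : Fin 2 → Fin n → ℕ) (τ : Fin n → Fin 2) {a b : ℕ → ℕ}
    (ha : ∀ j : Fin n, a j = p 0 j) (hb : ∀ j : Fin n, b j = p 1 j) {T : Finset ℕ}
    (hT : T ⊆ range n) (hτ : ∀ j : Fin n, (j : ℕ) ∈ T ↔ τ j = 0) :
    cost n a b T = makespan p τ := by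
  have h0 : load p τ 0 = ∑ j ∈ T, a j := by
    have e : T = {i ∈ range n | i ∈ T} := by
      ext i
      simpa using fun hi => mem_range.1 (hT hi)
    rw [load, sum_filter, e, sum_filter, sum_range]
    exact sum_congr rfl fun j _ => by simp only [hτ, ha]
  have h1 : load p τ 1 = ∑ j ∈ range n \ T, b j := by
    have e : range n \ T = {i ∈ range n | i ∉ T} := by
      ext i
      simp
    rw [load, sum_filter, e, sum_filter, sum_range]
    refine sum_congr rfl fun j _ => ?_
    have : τ j = 1 ↔ ¬ τ j = 0 := by omega
    simp only [hτ, hb, this]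
  have h2 : (univ : Finset (Fin 2)) = {0, 1} := by decide
  rw [makespan, h2, sup_insert, sup_singleton, h0, h1]
  rfl

def solve : Program := seq scan (seq greedy (seq fillTable (seq select traceBack)))

theorem finish_spec {n P B : ℕ} {a b : ℕ → ℕ} {s : State} {G : Finset ℕ} (hP : 0 < P)
    (ha : ∀ j, a j ≤ P) (hb : ∀ j, b j ≤ P) (hG : Reference n P a b G) (hm : Input n a b s.mem)
    (hGm : ∀ j < n, s.mem (n + n + j) * a j = if j ∈ G then a j else 0)
    (hz : ∀ y, n + n + n ≤ y → s.mem y = 0)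
    (hs : Setup n (P ^ 4) (∑ j ∈ range n, b j) (∑ j ∈ G, a j) s)
    (hB : 12 * (n * P ^ 4) + 3 * n + 29 * P ^ 4 ≤ B) :
    Triple B (seq fillTable (seq select traceBack)) (171 * (n * P ^ 4) + 50 * n + 330 * P ^ 4) s
      fun s' => ∃ S ⊆ range n, (∀ T ⊆ range n, cost n a b S ≤ cost n a b T) ∧
        (∀ i < n, s'.mem i = if i ∈ S then 0 else 1) ∧ s'.reg 0 = cost n a b S := by
  obtain ⟨c, hc⟩ : ∃ c : ℕ → ℕ, ∀ j, c j = if j ∈ G then a j else 0 := ⟨_, fun _ => rfl⟩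
  obtain ⟨Q, hQ⟩ : ∃ Q, Q = P ^ 4 := ⟨_, rfl⟩
  obtain ⟨z₀, hz₀, hz₀', hz₀p, hz₀le⟩ := hG.exists_index hP ha hb hc hQ
  have hPQ : P ≤ Q := hQ ▸ Nat.le_self_pow (by norm_num) P
  simp only [← hc] at hGm
  rw [← hQ] at hs hB ⊢
  have hg : ∑ j ∈ G, a j = ∑ j ∈ range n, c j := by
    rw [sum_congr rfl fun j _ => hc j, ← sum_filter]
    refine sum_congr ?_ fun _ _ => rfl
    ext i
    simpa using fun hi => mem_range.1 (hG.sub hi)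
  have haQ := fun j => (ha j).trans hPQ
  have hbQ := fun j => (hb j).trans hPQ
  have hcQ : ∀ j, c j ≤ Q := fun j => by
    rw [hc]
    split
    · exact haQ j
    · exact Nat.zero_le _
  have hgQ := sum_range_le hcQ n
  have htQ := sum_range_le hbQ n
  rw [← hg] at hgQ
  have hnQ : n * (9 * Q) = 9 * (n * Q) := by ring
  refine (Triple.seq (fillTable_spec (by omega) hs hm (fun j hj => hGm j hj) hz haQ hcQ hbQ
    (by omega)) fun s₁ h₁ => Triple.seq (select_spec (T := table n Q a b c n) h₁.toTableRegs
      (by rw [h₁.r21, Nat.sub_self, zero_mul, add_zero]) (fun x hx => ?_) (by omega))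
      fun s₂ h₂ => ?_).mono (N := n * (Q * 140 + 31) + 20 + (Q * 280 + 20 + (n * 50 + 10)))
      ?_ fun _ h => h
  · have := h₁.rows 0 (Nat.zero_le _) (by omega) x hx
    rwa [zero_mul, add_zero, Nat.sub_zero] at this
  · have hlow := h₂.low z₀ hz₀ (by omega) hz₀p
    have hopt : ∀ T ⊆ range n, s₂.reg 26 ≤ cost n a b T := fun T hT => by
      refine le_trans ?_ (hz₀le T hT)
      rwa [entryValue, ← hg]
    -- Putting all jobs on machine 1 beats the initial value `t + 1`, so the search has selected a
    -- genuine entry.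
    have hempty : s₂.reg 26 ≤ ∑ j ∈ range n, b j := by
      simpa [cost] using hopt ∅ (empty_subset _)
    obtain ⟨hzp, hzv⟩ := h₂.best.resolve_left (by omega)
    refine (traceBack_spec h₂.toTableRegs ?_ ?_ ?_ haQ hcQ hbQ (by omega) h₂.r21 rfl rfl hzp
      (by omega)).mono le_rfl ?_
    · rw [h₂.mem]
      exact ⟨fun j hj => by rw [h₁.low _ (by omega), hm.left j hj],
        fun j hj => by rw [h₁.low _ (by omega), hm.right j hj]⟩
    · rw [h₂.mem]
      exact fun j hj => by rw [h₁.low _ (by omega), hGm j hj]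
    · rw [h₂.mem]
      exact fun j hj x hx => h₁.rows j hj (by omega) x hx
    · rintro s₃ ⟨h0, x, S, hS, hSm⟩
      have e : s₂.reg 26 = cost n a b S := by rw [hS.cost_eq, hzv, entryValue, hg]
      exact ⟨S, hS.sub, fun T hT => e ▸ hopt T hT, hSm, h0.trans e⟩
  · nlinarith

theorem solve_spec {n M B : ℕ} {a b : ℕ → ℕ} {s : State} (hs0 : s.reg 0 = n)
    (hs : ∀ x, x ≠ 0 → s.reg x = 0) (hm : Input n a b s.mem) (hz : ∀ y, n + n ≤ y → s.mem y = 0)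
    (ha0 : ∀ j, j < n ∨ a j = 0) (hb0 : ∀ j, j < n ∨ b j = 0) (ha : ∀ j, a j ≤ M)
    (hb : ∀ j, b j ≤ M) (hM : 0 < M) (hB : (n + 1) * (40 * M ^ 4) ≤ B) :
    Triple B solve ((n + 1) * (420 * M ^ 4)) s fun s' => ∃ S ⊆ range n,
      (∀ T ⊆ range n, cost n a b S ≤ cost n a b T) ∧
      (∀ i < n, s'.mem i = if i ∈ S then 0 else 1) ∧ s'.reg 0 = cost n a b S := by
  have q1 : M ≤ M ^ 4 := Nat.le_self_pow (by norm_num) M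
  have q3 : M ^ 3 ≤ M ^ 4 := Nat.pow_le_pow_right hM (by norm_num)
  have q0 : 1 ≤ M ^ 4 := Nat.one_le_pow _ _ hM
  have r1 : n * M ≤ n * M ^ 4 := Nat.mul_le_mul_left _ q1
  have r3 : n * M ^ 3 ≤ n * M ^ 4 := Nat.mul_le_mul_left _ q3
  have r0 : n ≤ n * M ^ 4 := Nat.le_mul_of_pos_right _ q0
  have hB' : 40 * (n * M ^ 4) + 40 * M ^ 4 ≤ B := by
    calc _ = (n + 1) * (40 * M ^ 4) := by ring
      _ ≤ B := hB
  refine (Triple.seq (scan_spec hs0 hs hm ha hb hM (by omega)) fun s₁ h₁ =>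
    Triple.seq (greedy_spec ha0 hb0 (by rw [h₁.mem]; exact h₁) (by rw [h₁.mem]; exact hm)
      (by rw [h₁.mem]; exact hz) (by omega)) ?_).mono
    (N := n * 40 + 40 + (M ^ 3 * (n * 40 + 41) + 9 +
      (171 * (n * M ^ 4) + 50 * n + 330 * M ^ 4))) ?_ fun _ h => h
  · rintro s₂ ⟨P, G, hP, hPM, haP, hbP, hG, hm₂, hGm, hz₂, hs₂⟩
    have t4 : P ^ 4 ≤ M ^ 4 := Nat.pow_le_pow_left hPM 4
    have t5 : n * P ^ 4 ≤ n * M ^ 4 := Nat.mul_le_mul_left _ t4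
    exact (finish_spec hP haP hbP hG hm₂ hGm hz₂ hs₂ (by omega)).mono (by omega) fun _ h => h
  · have : M ^ 3 * (n * 40 + 41) = 40 * (n * M ^ 3) + 41 * M ^ 3 := by ring
    have : (n + 1) * (420 * M ^ 4) = 420 * (n * M ^ 4) + 420 * M ^ 4 := by ring
    omega

/-- The bit length of the numbers that occur. -/
theorem size_bound (n P : ℕ) :
    2 * ((n + 1) * (40 * max P 1 ^ 4)).size + 1 ≤ 33 * Nat.log 2 (n + P + 2) := by
  obtain ⟨d, hd⟩ : ∃ d, d = n + P + 2 := ⟨_, rfl⟩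
  obtain ⟨l, hl⟩ : ∃ l, l = Nat.log 2 d := ⟨_, rfl⟩
  have h1 : 1 ≤ l := by
    rw [hl]
    exact Nat.log_pos (by norm_num) (by omega)
  have h2 : d < 2 ^ (l + 1) := hl ▸ Nat.lt_pow_succ_log_self (by norm_num) d
  -- Both `n + 1` and `max P 1` are at most `d`. The bit length is thus at most `11 + 5 * l`, and
  -- `23 + 10 * l ≤ 33 * l` because `1 ≤ l`.
  have h3 : (n + 1) * (40 * max P 1 ^ 4) < 2 ^ (6 + (l + 1) * 5) := by
    calc (n + 1) * (40 * max P 1 ^ 4) ≤ d * (40 * d ^ 4) := by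
          gcongr <;> omega
      _ = 40 * d ^ 5 := by ring
      _ < 2 ^ 6 * (2 ^ (l + 1)) ^ 5 := by
          refine Nat.mul_lt_mul_of_lt_of_le (by norm_num) (Nat.pow_le_pow_left h2.le 5) ?_
          positivity
      _ = 2 ^ (6 + (l + 1) * 5) := by rw [← pow_mul, ← pow_add]
  have h4 := Nat.size_le.2 h3
  rw [← hd, ← hl]
  omega

theorem le_pmax {n : ℕ} (p : Fin 2 → Fin n → ℕ) (i : Fin 2) (j : Fin n) : p i j ≤ pmax p :=
  (le_sup (f := fun j => p i j) (mem_univ j)).trans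
    (le_sup (f := fun i => univ.sup fun j => p i j) (mem_univ i))

theorem inputState_mem_le {n : ℕ} (p : Fin 2 → Fin n → ℕ) (y : ℕ) :
    (inputState p).mem y ≤ pmax p := by
  unfold inputState
  dsimp only
  split
  · exact le_pmax p _ _
  · exact Nat.zero_le _

theorem inputState_mem_eq_zero {n : ℕ} (p : Fin 2 → Fin n → ℕ) {y : ℕ} (hy : n + n ≤ y) :
    (inputState p).mem y = 0 := by
  unfold inputState
  dsimp only
  rw [dif_neg (by omega)]

/-- The constant is `2 * 420 * 33`: from `n + 1 ≤ 2 * max n 1`, the step count of `solve_spec` and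
the cost per step of `size_bound`. The fourth power is simply weakened to the sixth. -/
theorem solve_solvesWithin : SolvesWithin solve fun n p =>
    27720 * (max (pmax p) 1 ^ 6 * max n 1) * Nat.log 2 (n + pmax p + 2) ^ 1 := by
  intro n p
  obtain ⟨M, hM⟩ : ∃ M, M = max (pmax p) 1 := ⟨_, rfl⟩
  have hM0 : 0 < M := by omega
  have hmM : ∀ y, (inputState p).mem y ≤ M := fun y =>
    (inputState_mem_le p y).trans (by omega)
  have hzero : ∀ y, n + n ≤ y → (inputState p).mem y = 0 := fun y => inputState_mem_eq_zero p
  have h4 : 1 ≤ M ^ 4 := Nat.one_le_pow _ _ hM0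
  have hBn : n + 1 ≤ (n + 1) * (40 * M ^ 4) := Nat.le_mul_of_pos_right _ (by omega)
  have hBM : M ≤ (n + 1) * (40 * M ^ 4) := by
    calc M ≤ M ^ 4 := Nat.le_self_pow (by norm_num) M
      _ ≤ 40 * M ^ 4 := by omega
      _ ≤ _ := Nat.le_mul_of_pos_left _ (by omega)
  obtain ⟨s, t, he, ht, -, S, hS, hopt, hSm, hS0⟩ := solve_spec (n := n)
    (B := (n + 1) * (40 * M ^ 4)) (a := fun j => (inputState p).mem (j + j))
    (b := fun j => (inputState p).mem (j + j + 1)) (s := inputState p) rfl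
    (fun x hx => if_neg hx) ⟨fun _ _ => rfl, fun _ _ => rfl⟩ hzero
    (fun j => (lt_or_ge j n).imp_right fun h => hzero _ (by omega))
    (fun j => (lt_or_ge j n).imp_right fun h => hzero _ (by omega))
    (fun j => hmM _) (fun j => hmM _) hM0 le_rfl
    ⟨fun x => by
      unfold inputState
      dsimp only
      split <;> omega, fun y => (hmM y).trans hBM⟩
  have ha : ∀ j : Fin n, (inputState p).mem (j + j) = p 0 j := by
    intro j
    have e : ((j : ℕ) + j) / 2 = j := by omega
    have e' : ((j : ℕ) + j) % 2 = 0 := by omega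
    simp [inputState, e, e']
  have hb : ∀ j : Fin n, (inputState p).mem (j + j + 1) = p 1 j := by
    intro j
    have e : ((j : ℕ) + j + 1) / 2 = j := by omega
    have e' : ((j : ℕ) + j + 1) % 2 = 1 := by omega
    simp [inputState, e, e']
  have hcost := fun τ T => cost_eq_makespan (T := T) p τ
    (a := fun j => (inputState p).mem (j + j)) (b := fun j => (inputState p).mem (j + j + 1)) ha hb
  have hσ := hcost (fun j => if (j : ℕ) ∈ S then 0 else 1) S hS (by simp)
  refine ⟨s, t, he, ⟨fun j => if (j : ℕ) ∈ S then 0 else 1, fun τ => ?_, fun j => ?_, ?_⟩, ?_⟩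
  · have hsub : ({j : Fin n | τ j = 0} : Finset (Fin n)).map Fin.valEmbedding ⊆ range n := by
      intro i
      simp only [mem_map, mem_range, Fin.valEmbedding_apply]
      rintro ⟨j, -, rfl⟩
      exact j.2
    rw [← hσ, ← hcost τ _ hsub fun j => (mem_map' Fin.valEmbedding).trans (by simp)]
    exact hopt _ hsub
  · rw [hSm j j.2]
    by_cases hj : (j : ℕ) ∈ S <;> simp [hj]
  · rw [hS0, hσ]
  · refine ht.trans ?_
    have h6 : M ^ 4 ≤ M ^ 6 := Nat.pow_le_pow_right hM0 (by norm_num)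
    have hsz := size_bound n (pmax p)
    beta_reduce
    rw [← hM] at hsz ⊢
    calc (n + 1) * (420 * M ^ 4) * (2 * ((n + 1) * (40 * M ^ 4)).size + 1)
        ≤ (2 * max n 1) * (420 * M ^ 6) * (33 * Nat.log 2 (n + pmax p + 2)) := by
          gcongr
          omega
      _ = _ := by ring

end Makespan

theorem mainTheorem6 :
    ∃ (c : RAM.Program) (K k : ℕ), Makespan.SolvesWithin c fun n p =>
      K * (max (Makespan.pmax p) 1 ^ 6 * max n 1) *
        Nat.log 2 (n + Makespan.pmax p + 2) ^ k :=
  ⟨_, _, _, Makespan.solve_solvesWithin⟩
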